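/- Let $U$ be a separable real Banach space with dual $U^*$. A cylindrical set is a set $\{u\in U:(\langle u,a_1\rangle,\dots,\langle u,a_n\rangle)\in B\}$ with $a_1,\dots,a_n\in U^*$ and $B\subseteq\mathbb R^n$ Borel. Let $\mathcal Z(U)$ be the algebra of all cylindrical sets and, for $\Gamma\subseteq U^*$, let $\mathcal C(U,\Gamma)$ be the $\sigma$-algebra generated by the cylindrical sets with $a_1,\dots,a_n\in\Gamma$; for finite $\Gamma$ it is contained in $\mathcal Z(U)$. A cylindrical measure is a function $\nu:\mathcal Z(U)\to[0,\infty]$ whose restriction to $\mathcal C(U,\Gamma)$ is a measure for every finite $\Gamma\subseteq U^*$; it is a cylindrical probability measure if moreover $\nu(U)=1$. For $a\in U^*$, $\nu\circ a^{-1}$ denotes the image measure on the Borel sets of $\mathbb R$. The convolution of cylindrical probability measures is $(\mu_1*\mu_2)(A)=\int\int 1_A(x+y)\,\mu_1(dx)\,\mu_2(dy)$ for $A\in\mathcal Z(U)$, and $\mu$ is infinitely divisible if for every $n\ge1$ there is a cylindrical probability measure $\rho$ whose $n$-fold convolution $\rho^{*n}$ equals $\mu$. **Theorem.** Let $\mu$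 be an infinitely divisible cylindrical probability measure on $\mathcal Z(U)$. Then there exists a cylindrical measure $\nu$ on $\mathcal Z(U)$ such that, for every $a\in U^*$, the Lévy measure of $\mu\circ a^{-1}$ is the restriction of $\nu\circ a^{-1}$ to $\mathbb R\setminus\{0\}$. That is, for every $a\in U^*$, $$\int_{\mathbb R\setminus\{0\}}\min(1,\gamma^2)\,(\nu\circ a^{-1})(d\gamma)<\infty ,$$ and there are $\beta_a\in\mathbb R$ and $\sigma_a\ge 0$ such that for all $t\in\mathbb R$ $$\int_{\mathbb R}e^{it\gamma}\,(\mu\circ a^{-1})(d\gamma)=\exp\Big(i\beta_a t-\tfrac12\sigma_a^2t^2+\int_{\mathbb R\setminus\{0\}}\big(e^{it\gamma}-1-it\gamma\,1_{\{|\gamma|\le1\}}\big)\,(\nu\circ a^{-1})(d\gamma)\Big).$$ -/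

import Mathlib

open MeasureTheory Set
open scoped ENNReal

noncomputable section

namespace CylLevy

variable {U : Type*} [NormedAddCommGroup U] [NormedSpace ℝ U]

/-- The map `u ↦ (⟨u, a₁⟩, …, ⟨u, aₙ⟩)` from `U` to `ℝⁿ`. -/
def proj {n : ℕ} (a : Fin n → StrongDual ℝ U) (u : U) : Fin n → ℝ := fun i => a i u

/-- The family `Z(U, Γ)` of cylindrical sets `{u : (⟨u, a₁⟩, …, ⟨u, aₙ⟩) ∈ B}` with
`a₁, …, aₙ ∈ Γ` and `B` a Borel subset of `ℝⁿ`. -/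
def cylinderSets (Γ : Set (StrongDual ℝ U)) : Set (Set U) :=
  {Z | ∃ (n : ℕ) (a : Fin n → StrongDual ℝ U) (B : Set (Fin n → ℝ)),
    (∀ i, a i ∈ Γ) ∧ MeasurableSet B ∧ Z = proj a ⁻¹' B}

/-- The cylindrical σ-algebra `C(U, Γ)`, generated by `Z(U, Γ)`. -/
def cylSigma (Γ : Set (StrongDual ℝ U)) : MeasurableSpace U :=
  MeasurableSpace.generateFrom (cylinderSets Γ)

variable (U) in
/-- The cylindrical algebra `Z(U) = Z(U, U*)`. -/
def cylAlgebra : Set (Set U) := cylinderSets (Set.univ : Set (StrongDual ℝ U))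

theorem cylinderSets_mono {Γ Δ : Set (StrongDual ℝ U)} (h : Γ ⊆ Δ) :
    cylinderSets Γ ⊆ cylinderSets Δ := by
  rintro Z ⟨n, a, B, ha, hB, rfl⟩
  exact ⟨n, a, B, fun i => h (ha i), hB, rfl⟩

theorem cylSigma_mono {Γ Δ : Set (StrongDual ℝ U)} (h : Γ ⊆ Δ) :
    cylSigma Γ ≤ cylSigma Δ :=
  MeasurableSpace.generateFrom_mono (cylinderSets_mono h)

theorem measurable_proj {Γ : Set (StrongDual ℝ U)} {n : ℕ} {a : Fin n → StrongDual ℝ U}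
    (ha : ∀ i, a i ∈ Γ) : @Measurable _ _ (cylSigma Γ) _ (proj a) := fun B hB =>
  MeasurableSpace.measurableSet_generateFrom ⟨n, a, B, ha, hB, rfl⟩

theorem measurable_functional {Γ : Set (StrongDual ℝ U)} {a : StrongDual ℝ U} (ha : a ∈ Γ) :
    @Measurable _ _ (cylSigma Γ) _ (fun u => a u) :=
  (measurable_pi_apply (0 : Fin 1)).comp
    (measurable_proj (a := fun _ : Fin 1 => a) (fun _ => ha))

/-- For a finite `Γ` the algebra `Z(U, Γ)` is already the σ-algebra `C(U, Γ)`. -/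
theorem mem_cylinderSets_of_measurableSet (Γ : Finset (StrongDual ℝ U)) {A : Set U}
    (hA : MeasurableSet[cylSigma (Γ : Set (StrongDual ℝ U))] A) :
    A ∈ cylinderSets (Γ : Set (StrongDual ℝ U)) := by
  let f : U → (Γ → ℝ) := fun u g => g.1 u
  have hle : cylSigma (Γ : Set (StrongDual ℝ U)) ≤ MeasurableSpace.comap f inferInstance := by
    refine MeasurableSpace.generateFrom_le ?_
    rintro Z ⟨n, a, B, ha, hB, rfl⟩
    refine ⟨(fun (x : Γ → ℝ) (i : Fin n) => x ⟨a i, ha i⟩) ⁻¹' B, ?_, rfl⟩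
    exact (measurable_pi_lambda _ fun i => measurable_pi_apply _) hB
  obtain ⟨B, hB, rfl⟩ := hle A hA
  refine ⟨Γ.card, fun i => (Γ.equivFin.symm i).1,
    (fun (x : Fin Γ.card → ℝ) (g : Γ) => x (Γ.equivFin g)) ⁻¹' B,
    fun i => (Γ.equivFin.symm i).2,
    (measurable_pi_lambda _ fun i => measurable_pi_apply _) hB, ?_⟩
  ext u
  simp [f, proj]

theorem mem_cylAlgebra (Γ : Finset (StrongDual ℝ U)) {A : Set U}
    (hA : MeasurableSet[cylSigma (Γ : Set (StrongDual ℝ U))] A) : A ∈ cylAlgebra U :=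
  cylinderSets_mono (Set.subset_univ _) (mem_cylinderSets_of_measurableSet Γ hA)

theorem exists_finset_measurableSet {A : Set U} (hA : A ∈ cylAlgebra U) :
    ∃ Γ : Finset (StrongDual ℝ U), MeasurableSet[cylSigma (Γ : Set (StrongDual ℝ U))] A := by
  classical
  obtain ⟨n, a, B, -, hB, rfl⟩ := hA
  exact ⟨Finset.univ.image a, measurable_proj (by simp) hB⟩

theorem univ_mem_cylAlgebra : (Set.univ : Set U) ∈ cylAlgebra U :=
  mem_cylAlgebra ∅ (@MeasurableSet.univ U (cylSigma _))

/-- Addition on `U` is measurable for the σ-algebra `C(U, Γ)`. -/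
theorem measurableAdd₂_cylSigma (Γ : Set (StrongDual ℝ U)) :
    @MeasurableAdd₂ U (cylSigma Γ) _ := by
  letI : MeasurableSpace U := cylSigma Γ
  refine ⟨measurable_generateFrom ?_⟩
  rintro Z ⟨n, a, B, ha, hB, rfl⟩
  have h : Measurable fun p : U × U => proj a p.1 + proj a p.2 :=
    ((measurable_proj ha).comp measurable_fst).add ((measurable_proj ha).comp measurable_snd)
  have he : (fun p : U × U => p.1 + p.2) ⁻¹' (proj a ⁻¹' B)
      = (fun p : U × U => proj a p.1 + proj a p.2) ⁻¹' B := by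
    ext p
    simp only [Set.mem_preimage]
    have : proj a (p.1 + p.2) = proj a p.1 + proj a p.2 := by
      funext i
      simp [proj]
    rw [this]
  rw [he]
  exact h hB

variable (U) in
/-- A cylindrical measure: a function `Z(U) → [0, ∞]` whose restriction to the σ-algebra
`C(U, Γ)` is a measure for each finite set `Γ` of functionals. -/
@[ext]
structure CylindricalMeasure where
  /-- The value on a cylindrical set. -/
  toFun : cylAlgebra U → ℝ≥0∞
  exists_restriction : ∀ Γ : Finset (StrongDual ℝ U),
    ∃ m : @Measure U (cylSigma (Γ : Set (StrongDual ℝ U))),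
      ∀ (A : Set U) (hA : MeasurableSet[cylSigma (Γ : Set (StrongDual ℝ U))] A),
        m A = toFun ⟨A, mem_cylAlgebra Γ hA⟩

namespace CylindricalMeasure

/-- The restriction of a cylindrical measure to `C(U, Γ)`, for a finite `Γ`, as a measure. -/
def restriction (ν : CylindricalMeasure U) (Γ : Finset (StrongDual ℝ U)) :
    @Measure U (cylSigma (Γ : Set (StrongDual ℝ U))) :=
  (ν.exists_restriction Γ).choose

theorem restriction_apply (ν : CylindricalMeasure U) (Γ : Finset (StrongDual ℝ U)) {A : Set U}
    (hA : MeasurableSet[cylSigma (Γ : Set (StrongDual ℝ U))] A) :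
    ν.restriction Γ A = ν.toFun ⟨A, mem_cylAlgebra Γ hA⟩ :=
  (ν.exists_restriction Γ).choose_spec A hA

/-- The image measure `ν ∘ a⁻¹` on the Borel sets of `ℝ`, for a functional `a`. -/
def image (ν : CylindricalMeasure U) (a : StrongDual ℝ U) : Measure ℝ :=
  @Measure.map U ℝ (cylSigma (({a} : Finset (StrongDual ℝ U)) : Set (StrongDual ℝ U))) _
    (fun u => a u) (ν.restriction {a})

theorem preimage_mem_cylAlgebra (a : StrongDual ℝ U) {B : Set ℝ} (hB : MeasurableSet B) :
    (fun u => a u) ⁻¹' B ∈ cylAlgebra U :=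
  mem_cylAlgebra {a} (measurable_functional (by simp) hB)

theorem image_apply (ν : CylindricalMeasure U) (a : StrongDual ℝ U) {B : Set ℝ}
    (hB : MeasurableSet B) :
    ν.image a B = ν.toFun ⟨(fun u => a u) ⁻¹' B, preimage_mem_cylAlgebra a hB⟩ := by
  have hm : @Measurable _ _ (cylSigma (({a} : Finset (StrongDual ℝ U)) : Set (StrongDual ℝ U))) _
    (fun u => a u) := measurable_functional (by simp)
  rw [image, Measure.map_apply hm hB, restriction_apply ν {a} (hm hB)]

theorem map_id_restriction (ν : CylindricalMeasure U) {Γ Δ : Finset (StrongDual ℝ U)}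
    (h : Γ ⊆ Δ) :
    @Measure.map U U (cylSigma (Δ : Set (StrongDual ℝ U))) (cylSigma (Γ : Set (StrongDual ℝ U)))
      id (ν.restriction Δ) = ν.restriction Γ := by
  have hle := cylSigma_mono (Finset.coe_subset.mpr h)
  refine @Measure.ext U (cylSigma (Γ : Set (StrongDual ℝ U))) _ _ fun A hA => ?_
  rw [@Measure.map_apply U U (cylSigma (Δ : Set (StrongDual ℝ U)))
    (cylSigma (Γ : Set (StrongDual ℝ U))) _ _ (measurable_id'' hle) _ hA, Set.preimage_id,
    restriction_apply ν Δ (hle A hA), restriction_apply ν Γ hA]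

end CylindricalMeasure

variable (U) in
/-- A cylindrical probability measure: a cylindrical measure `μ` with `μ(U) = 1`. -/
@[ext]
structure CylindricalProbabilityMeasure extends CylindricalMeasure U where
  apply_univ : toFun ⟨Set.univ, univ_mem_cylAlgebra⟩ = 1

namespace CylindricalProbabilityMeasure

theorem isProbabilityMeasure_restriction (μ : CylindricalProbabilityMeasure U)
    (Γ : Finset (StrongDual ℝ U)) :
    @IsProbabilityMeasure U (cylSigma (Γ : Set (StrongDual ℝ U)))
      (μ.toCylindricalMeasure.restriction Γ) := by
  letI : MeasurableSpace U := cylSigma (Γ : Set (StrongDual ℝ U))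
  refine ⟨?_⟩
  rw [CylindricalMeasure.restriction_apply _ Γ MeasurableSet.univ]
  exact μ.apply_univ

/-- The convolution, in `(U, C(U, Γ))`, of the restrictions of `μ₁` and `μ₂` to `C(U, Γ)`;
on `A ∈ C(U, Γ)` it takes the value `∫ ∫ 1_A(x + y) μ₁(dx) μ₂(dy)`. -/
def convOn (μ₁ μ₂ : CylindricalProbabilityMeasure U) (Γ : Finset (StrongDual ℝ U)) :
    @Measure U (cylSigma (Γ : Set (StrongDual ℝ U))) :=
  @Measure.conv U _ (cylSigma (Γ : Set (StrongDual ℝ U)))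
    (μ₁.toCylindricalMeasure.restriction Γ) (μ₂.toCylindricalMeasure.restriction Γ)

theorem isProbabilityMeasure_convOn (μ₁ μ₂ : CylindricalProbabilityMeasure U)
    (Γ : Finset (StrongDual ℝ U)) :
    @IsProbabilityMeasure U (cylSigma (Γ : Set (StrongDual ℝ U))) (convOn μ₁ μ₂ Γ) := by
  letI : MeasurableSpace U := cylSigma (Γ : Set (StrongDual ℝ U))
  haveI := measurableAdd₂_cylSigma (Γ : Set (StrongDual ℝ U))
  haveI := isProbabilityMeasure_restriction μ₁ Γ
  haveI := isProbabilityMeasure_restriction μ₂ Γ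
  unfold convOn
  infer_instance

theorem convOn_apply_of_subset (μ₁ μ₂ : CylindricalProbabilityMeasure U)
    {Γ Δ : Finset (StrongDual ℝ U)} (h : Γ ⊆ Δ) {A : Set U}
    (hA : MeasurableSet[cylSigma (Γ : Set (StrongDual ℝ U))] A) :
    convOn μ₁ μ₂ Δ A = convOn μ₁ μ₂ Γ A := by
  have hle := cylSigma_mono (Finset.coe_subset.mpr h)
  haveI := isProbabilityMeasure_restriction μ₁ Δ
  haveI := isProbabilityMeasure_restriction μ₂ Δ
  have key := @Measure.map_conv_addMonoidHom U U (cylSigma (Δ : Set (StrongDual ℝ U))) _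
    (measurableAdd₂_cylSigma _) (cylSigma (Γ : Set (StrongDual ℝ U))) _
    (measurableAdd₂_cylSigma _) (μ₁.toCylindricalMeasure.restriction Δ)
    (μ₂.toCylindricalMeasure.restriction Δ) inferInstance inferInstance
    (AddMonoidHom.id U) (measurable_id'' hle)
  have hid : ⇑(AddMonoidHom.id U) = id := rfl
  rw [hid, CylindricalMeasure.map_id_restriction _ h,
    CylindricalMeasure.map_id_restriction _ h] at key
  unfold convOn
  rw [← key, @Measure.map_apply U U (cylSigma (Δ : Set (StrongDual ℝ U)))
    (cylSigma (Γ : Set (StrongDual ℝ U))) _ _ (measurable_id'' hle) _ hA, Set.preimage_id]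

theorem convOn_apply_eq (μ₁ μ₂ : CylindricalProbabilityMeasure U)
    {Γ Δ : Finset (StrongDual ℝ U)} {A : Set U}
    (hΓ : MeasurableSet[cylSigma (Γ : Set (StrongDual ℝ U))] A)
    (hΔ : MeasurableSet[cylSigma (Δ : Set (StrongDual ℝ U))] A) :
    convOn μ₁ μ₂ Γ A = convOn μ₁ μ₂ Δ A := by
  classical
  rw [← convOn_apply_of_subset μ₁ μ₂ (Finset.subset_union_left (s₂ := Δ)) hΓ,
    ← convOn_apply_of_subset μ₁ μ₂ (Finset.subset_union_right (s₁ := Γ)) hΔ]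

/-- The convolution `μ₁ * μ₂`, with `(μ₁ * μ₂)(A) = ∫ ∫ 1_A(x + y) μ₁(dx) μ₂(dy)` for
`A ∈ Z(U)`. The integrals are taken in `C(U, Γ)` for a finite `Γ` with `A ∈ C(U, Γ)`; by
`convOn_apply_eq` the value does not depend on `Γ`. -/
def conv (μ₁ μ₂ : CylindricalProbabilityMeasure U) : CylindricalProbabilityMeasure U where
  toFun A := convOn μ₁ μ₂ (exists_finset_measurableSet A.2).choose A
  exists_restriction Γ := ⟨convOn μ₁ μ₂ Γ, fun A hA =>
    convOn_apply_eq μ₁ μ₂ hA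
      (exists_finset_measurableSet (mem_cylAlgebra Γ hA)).choose_spec⟩
  apply_univ :=
    @IsProbabilityMeasure.measure_univ U (cylSigma _) _ (isProbabilityMeasure_convOn μ₁ μ₂ _)

theorem conv_apply (μ₁ μ₂ : CylindricalProbabilityMeasure U) (Γ : Finset (StrongDual ℝ U))
    {A : Set U} (hA : MeasurableSet[cylSigma (Γ : Set (StrongDual ℝ U))] A) :
    (conv μ₁ μ₂).toFun ⟨A, mem_cylAlgebra Γ hA⟩ = convOn μ₁ μ₂ Γ A :=
  convOn_apply_eq μ₁ μ₂
    (exists_finset_measurableSet (mem_cylAlgebra Γ hA)).choose_spec hA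

/-- The unit mass at the origin, the neutral element of the convolution. -/
def diracZero : CylindricalProbabilityMeasure U where
  toFun A := (A : Set U).indicator 1 0
  exists_restriction Γ := ⟨@Measure.dirac U (cylSigma (Γ : Set (StrongDual ℝ U))) 0,
    fun _ hA => @Measure.dirac_apply' U (cylSigma (Γ : Set (StrongDual ℝ U))) _ 0 hA⟩
  apply_univ := by simp

/-- The `n`-fold convolution `μ^{*n}` of `μ` with itself. -/
def convPow (μ : CylindricalProbabilityMeasure U) : ℕ → CylindricalProbabilityMeasure U
  | 0 => diracZero
  | n + 1 => conv (convPow μ n) μ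

/-- `μ` is infinitely divisible if for each `n ≥ 1` there is a cylindrical probability measure
`ρ` with `μ = ρ^{*n}`. -/
def IsInfinitelyDivisible (μ : CylindricalProbabilityMeasure U) : Prop :=
  ∀ n : ℕ, 1 ≤ n → ∃ ρ : CylindricalProbabilityMeasure U, μ = convPow ρ n

end CylindricalProbabilityMeasure

/-- A Lévy measure on `ℝ`: no mass at the origin and `∫ min(1, γ²) lam(dγ) < ∞`. -/
structure IsLevyMeasure (lam : Measure ℝ) : Prop where
  apply_zero : lam {0} = 0
  lintegral_lt_top : ∫⁻ γ, ENNReal.ofReal (min 1 (γ ^ 2)) ∂lam < ∞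

/-- The Lévy-Khintchine representation: the measure `P` on `ℝ` has drift `β`, Gaussian variance
`σ²` and Lévy measure `lam`, with the truncation function `γ ↦ γ 1_{|γ| ≤ 1}`. -/
structure HasLevyKhintchine (P : Measure ℝ) (β σ : ℝ) (lam : Measure ℝ) : Prop where
  nonneg : 0 ≤ σ
  isLevyMeasure : IsLevyMeasure lam
  charFun_eq : ∀ t : ℝ, charFun P t =
    Complex.exp (Complex.I * (t * β : ℝ) - (1 / 2 * σ ^ 2 * t ^ 2 : ℝ) +
      ∫ γ in ({0}ᶜ : Set ℝ), (Complex.exp (Complex.I * (t * γ : ℝ)) - 1 -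
        Complex.I * ((t * γ * (Set.Icc (-1) 1).indicator 1 γ : ℝ) : ℂ)) ∂lam)

end CylLevy

end

open MeasureTheory Set Filter Topology BoundedContinuousFunction
open scoped ENNReal NNReal

noncomputable section

/-! Let `ρ n` be an `n`-th convolution root of `μ`. For one functional, the Lévy measure should be
the limit off the origin of `n` times the image of `ρ n`; the same limit is taken of the images in
`ℝ^Γ` for every finite `Γ`, always along one nonprincipal ultrafilter. The common filter makes the
limits for different `Γ`, and those for single functionals, compatible by construction, so
uniqueness of Lévy measures is never needed.

Existence of the limits rests on `norm_charFun_root_sub_one_le`: near `0`, `n ‖φ_n - 1‖` is at most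
`3 ‖φ - 1‖`. This bounds the integrals of `min(1, x²)` and the tails uniformly in `n`
(`isLevyBounded_of_charFun_pow`), and coordinatewise bounds suffice in `ℝ^Γ` (`isLevyBounded_pi`).
Compactness then gives a weak limit `G` of the weighted measures. Division by the weight off the
origin gives the Lévy measure, and on the line the atom of `G` at `0` is the Gaussian variance. The
formula comes from `φ = (1 + (φ_n - 1))^n`, whose limit is the exponential of the limit of `n (φ_n -
1)`.

The limits `κ Γ` are compatible under linear maps only off the origin (`IsLevyLimit.preimage_eq`):
mass of `κ Δ` on vectors whose `Γ`-coordinates vanish is not seen by `κ Γ`, which does not charge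
`0`. Enlarging `Γ` can therefore only increase the mass of a cylindrical set
(`preimage_coordSection_mono`). The supremum over all finite sets of functionals is countably
additive on each `C(U, Γ)`, because a directed increasing supremum of measures is a measure. It
leaves masses off the origin unchanged, so its images have the right Lévy measures. -/

namespace CylLevy

/-! ### Limits of measures away from the origin -/

section LevyWeight

variable {E F : Type*} [NormedAddCommGroup E] [NormedAddCommGroup F]

/-- The weight `x ↦ min(1, ‖x‖²)`. -/
def levyWeight (x : E) : ℝ := min 1 (‖x‖ ^ 2)

theorem levyWeight_nonneg (x : E) : 0 ≤ levyWeight x := by unfold levyWeight; positivity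

theorem levyWeight_le_one (x : E) : levyWeight x ≤ 1 := min_le_left _ _

theorem levyWeight_pos {x : E} (hx : x ≠ 0) : 0 < levyWeight x := by
  unfold levyWeight; positivity

@[simp]
theorem levyWeight_zero : levyWeight (0 : E) = 0 := by simp [levyWeight]

theorem continuous_levyWeight : Continuous (levyWeight : E → ℝ) := by
  unfold levyWeight; fun_prop

theorem levyWeight_lower_bound {ε : ℝ} (hε : 0 < ε) {x : E} (hx : ε ≤ ‖x‖) :
    min 1 (ε ^ 2) ≤ levyWeight x :=
  min_le_min le_rfl (by gcongr)

variable [MeasurableSpace E] [BorelSpace E] [MeasurableSpace F] [BorelSpace F]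

/-- Uniform integrability of `min(1, ‖x‖²)` for a sequence of measures. -/
structure IsLevyBounded (m : ℕ → Measure E) : Prop where
  lintegral_le : ∃ C : ℝ≥0, ∀ n, ∫⁻ x, ENNReal.ofReal (levyWeight x) ∂(m n) ≤ C
  tail_le : ∀ ε : ℝ≥0, 0 < ε → ∃ R : ℝ, ∀ n, m n {x | R < ‖x‖} ≤ ε

theorem integral_withDensity_ofReal {X : Type*} [MeasurableSpace X] {μ : Measure X} {w : X → ℝ}
    (hw : Measurable w) (h0 : ∀ x, 0 ≤ w x) (g : X → ℝ) :
    ∫ x, g x ∂(μ.withDensity fun x => ENNReal.ofReal (w x)) = ∫ x, w x * g x ∂μ := by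
  rw [integral_withDensity_eq_integral_toReal_smul hw.ennreal_ofReal (by simp)]
  simp [ENNReal.toReal_ofReal (h0 _)]

/-- The ultrafilter limit of the measures `min(1, ‖x‖²) m n`. -/
theorem IsLevyBounded.exists_weak_limit [ProperSpace E] {m : ℕ → Measure E}
    (hm : IsLevyBounded m) (l : Ultrafilter ℕ) :
    ∃ G : Measure E, IsFiniteMeasure G ∧ ∀ g : E →ᵇ ℝ,
      Tendsto (fun n => ∫ x, levyWeight x * g x ∂(m n)) l (𝓝 (∫ x, g x ∂G)) := by
  obtain ⟨C, hC⟩ := hm.lintegral_le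
  have hw : Measurable (levyWeight : E → ℝ) := continuous_levyWeight.measurable
  let D : ℕ → Measure E := fun n => (m n).withDensity fun x => ENNReal.ofReal (levyWeight x)
  have hDuniv : ∀ n, D n univ ≤ C := fun n => by
    simpa [D, withDensity_apply _ MeasurableSet.univ] using hC n
  have hDfin : ∀ n, IsFiniteMeasure (D n) := fun n => ⟨(hDuniv n).trans_lt (by simp)⟩
  have hDle : ∀ n (s : Set E), MeasurableSet s → D n s ≤ m n s := fun n s hs => by
    rw [withDensity_apply _ hs]
    calc ∫⁻ x in s, ENNReal.ofReal (levyWeight x) ∂(m n) ≤ ∫⁻ _ in s, 1 ∂(m n) :=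
          lintegral_mono fun x => by simpa using levyWeight_le_one x
      _ = m n s := by simp
  let H : ℕ → FiniteMeasure E := fun n => ⟨D n, hDfin n⟩
  have hHC : ∀ n s, H n s ≤ C := fun n s => by
    have : (H n s : ℝ≥0∞) ≤ C := by
      rw [FiniteMeasure.ennreal_coeFn_eq_coeFn_toMeasure]
      exact (measure_mono (subset_univ s)).trans (hDuniv n)
    exact_mod_cast this
  -- The worst mass outside the ball of radius `k`. The tail bounds make it tend to `0`, which is
  -- the tightness that Prokhorov compactness requires.
  let u : ℕ → ℝ≥0 := fun k => ⨆ n, H n (Metric.closedBall (0 : E) k)ᶜ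
  have hbdd : ∀ k : ℕ, BddAbove (range fun n => H n (Metric.closedBall (0 : E) k)ᶜ) := fun k =>
    ⟨C, by rintro _ ⟨n, rfl⟩; exact hHC n _⟩
  have hu : Tendsto u atTop (𝓝 0) := by
    rw [tendsto_order]
    refine ⟨fun a ha => absurd ha (by simp), fun ε hε => ?_⟩
    obtain ⟨R, hR⟩ := hm.tail_le (ε / 2) (by positivity)
    obtain ⟨k₀, hk₀⟩ := exists_nat_ge R
    filter_upwards [eventually_ge_atTop k₀] with k hk
    refine lt_of_le_of_lt (ciSup_le fun n => ?_) (half_lt_self_iff.2 hε)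
    have hsub : (Metric.closedBall (0 : E) k)ᶜ ⊆ {x | R < ‖x‖} := fun x hx => by
      have hx' : (k : ℝ) < ‖x‖ := by simpa using hx
      have : (k₀ : ℝ) ≤ k := by exact_mod_cast hk
      exact lt_of_le_of_lt (hk₀.trans this) hx'
    have : (H n (Metric.closedBall (0 : E) k)ᶜ : ℝ≥0∞) ≤ (ε / 2 : ℝ≥0) := by
      rw [FiniteMeasure.ennreal_coeFn_eq_coeFn_toMeasure]
      exact (hDle n _ Metric.isClosed_closedBall.measurableSet.compl).trans
        ((measure_mono hsub).trans (hR n))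
    exact_mod_cast this
  have hcomp := isCompact_setOfPred_finiteMeasure_mass_le_compl_isCompact_le (E := E) C hu
    (K := fun k => Metric.closedBall (0 : E) k) (fun k => isCompact_closedBall _ _)
    (Or.inl inferInstance)
  obtain ⟨G, -, hG⟩ := isCompact_iff_ultrafilter_le_nhds.1 hcomp (l.map H) (by
    rw [le_principal_iff, Ultrafilter.coe_map, mem_map]
    exact Filter.mem_of_superset univ_mem fun n _ =>
      ⟨hHC n univ, fun k => le_ciSup (hbdd k) n⟩)
  refine ⟨G, inferInstance, fun g => ?_⟩
  have := FiniteMeasure.tendsto_iff_forall_integral_tendsto.1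
    (show Tendsto H l (𝓝 G) from hG) g
  refine this.congr fun n => ?_
  exact integral_withDensity_ofReal hw levyWeight_nonneg g

/-- The measure `min(1, ‖x‖²)⁻¹ G` off the origin. -/
def levyPart (G : Measure E) : Measure E :=
  (G.restrict {0}ᶜ).withDensity fun x => ENNReal.ofReal (levyWeight x)⁻¹

theorem levyPart_singleton_zero (G : Measure E) : levyPart G {0} = 0 := by
  rw [levyPart, withDensity_apply _ (measurableSet_singleton 0),
    Measure.restrict_restrict (measurableSet_singleton 0)]
  simp

theorem measurable_inv_levyWeight : Measurable fun x : E => (levyWeight x)⁻¹ :=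
  continuous_levyWeight.measurable.inv

theorem lintegral_levyWeight_levyPart (G : Measure E) :
    ∫⁻ x, ENNReal.ofReal (levyWeight x) ∂(levyPart G) = G {0}ᶜ := by
  rw [levyPart, lintegral_withDensity_eq_lintegral_mul₀ (by
      exact measurable_inv_levyWeight.ennreal_ofReal.aemeasurable)
    (by exact continuous_levyWeight.measurable.ennreal_ofReal.aemeasurable)]
  rw [setLIntegral_congr_fun (g := fun _ => 1) (measurableSet_singleton 0).compl]
  · simp
  · intro x hx
    have := levyWeight_pos (x := x) hx
    simp only [Pi.mul_apply]
    rw [← ENNReal.ofReal_mul (inv_nonneg.2 this.le), inv_mul_cancel₀ this.ne']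
    simp

theorem integral_levyPart (G : Measure E) (g : E → ℝ) :
    ∫ x, levyWeight x * g x ∂(levyPart G) = ∫ x in {0}ᶜ, g x ∂G := by
  rw [levyPart, integral_withDensity_ofReal measurable_inv_levyWeight
    (fun x => inv_nonneg.2 (levyWeight_nonneg x))]
  refine setIntegral_congr_fun (measurableSet_singleton 0).compl fun x hx => ?_
  have := levyWeight_pos (x := x) hx
  field_simp

/-- `ν` has no mass at the origin, integrates `min(1, ‖x‖²)`, and is the limit of `m` along `l`
against the bounded continuous functions that vanish near the origin. -/
structure IsLevyLimit (l : Filter ℕ) (m : ℕ → Measure E) (ν : Measure E) : Prop where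
  apply_zero : ν {0} = 0
  lintegral_lt_top : ∫⁻ x, ENNReal.ofReal (levyWeight x) ∂ν < ∞
  tendsto : ∀ (f : E →ᵇ ℝ) (ε : ℝ), 0 < ε → (∀ x, ‖x‖ ≤ ε → f x = 0) →
    Tendsto (fun n => ∫ x, f x ∂(m n)) l (𝓝 (∫ x, f x ∂ν))

/-- A test function vanishing near the origin is the weight times a bounded continuous function
vanishing at the origin, so neither the division by the weight nor the atom of `G` at `0` affects
its integral. -/
theorem isLevyLimit_levyPart {l : Filter ℕ} {m : ℕ → Measure E} {G : Measure E}
    [IsFiniteMeasure G]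
    (hG : ∀ g : E →ᵇ ℝ, Tendsto (fun n => ∫ x, levyWeight x * g x ∂(m n)) l (𝓝 (∫ x, g x ∂G))) :
    IsLevyLimit l m (levyPart G) := by
  refine ⟨levyPart_singleton_zero G, ?_, fun f ε hε hf => ?_⟩
  · rw [lintegral_levyWeight_levyPart]; exact measure_lt_top _ _
  set c : ℝ := min 1 (ε ^ 2) with hc
  have hcpos : 0 < c := by positivity
  -- The maximum with `c` keeps the denominator away from `0`; it changes nothing where `‖x‖ > ε`,
  -- and elsewhere `f` vanishes.
  let g : E →ᵇ ℝ := BoundedContinuousFunction.ofNormedAddCommGroup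
    (fun x => (max c (levyWeight x))⁻¹ * f x)
    ((Continuous.inv₀ (continuous_const.max continuous_levyWeight)
      fun x => (lt_max_of_lt_left hcpos).ne').mul f.continuous) (c⁻¹ * ‖f‖) (fun x => by
        rw [norm_mul, norm_inv, Real.norm_of_nonneg (hcpos.le.trans (le_max_left _ _))]
        gcongr
        · exact le_max_left _ _
        · exact f.norm_coe_le_norm x)
  have hg : ∀ x, levyWeight x * g x = f x := fun x => by
    simp only [g, BoundedContinuousFunction.coe_ofNormedAddCommGroup]
    by_cases hx : ‖x‖ ≤ ε
    · simp [hf x hx]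
    · have h1 := levyWeight_lower_bound hε (not_le.1 hx).le
      rw [max_eq_right h1, ← mul_assoc, mul_inv_cancel₀ (hcpos.trans_le h1).ne', one_mul]
  have h := hG g
  simp only [hg] at h
  convert h using 2
  simp only [← hg]
  rw [integral_levyPart]
  refine setIntegral_eq_integral_of_forall_compl_eq_zero fun x hx => ?_
  have hx0 : x = 0 := by simpa using hx
  simp [g, hx0, hf 0 (by simpa using hε.le)]

theorem IsLevyBounded.exists_isLevyLimit [ProperSpace E] {m : ℕ → Measure E}
    (hm : IsLevyBounded m) (l : Ultrafilter ℕ) : ∃ ν : Measure E, IsLevyLimit l m ν := by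
  obtain ⟨G, _, hG⟩ := hm.exists_weak_limit l
  exact ⟨_, isLevyLimit_levyPart hG⟩

theorem measure_lt_top_of_lintegral_levyWeight {ν : Measure E}
    (h : ∫⁻ x, ENNReal.ofReal (levyWeight x) ∂ν < ∞) {ε : ℝ} (hε : 0 < ε) :
    ν {x | ε ≤ ‖x‖} < ∞ := by
  have hc : ENNReal.ofReal (min 1 (ε ^ 2)) ≠ 0 := by
    rw [Ne, ENNReal.ofReal_eq_zero, not_le]; positivity
  refine lt_of_le_of_lt (measure_mono (t := {x | ENNReal.ofReal (min 1 (ε ^ 2)) ≤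
    ENNReal.ofReal (levyWeight x)}) fun x hx => ?_)
    ((meas_ge_le_lintegral_div (by
      exact continuous_levyWeight.measurable.ennreal_ofReal.aemeasurable) hc
        ENNReal.ofReal_ne_top).trans_lt (ENNReal.div_lt_top h.ne hc))
  exact ENNReal.ofReal_le_ofReal (levyWeight_lower_bound hε hx)

/-- Limits off the origin are compatible with continuous maps that fix the origin. -/
theorem IsLevyLimit.preimage_eq {l : Filter ℕ} [l.NeBot] {m : ℕ → Measure E}
    {ν : Measure E} (hν : IsLevyLimit l m ν) {T : E → F} (hT : Continuous T) (hT0 : T 0 = 0)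
    {ν' : Measure F} (hν' : IsLevyLimit l (fun n => (m n).map T) ν') {B : Set F}
    (hB : MeasurableSet B) (h0 : (0 : F) ∉ B) : ν' B = ν (T ⁻¹' B) := by
  have hTm := hT.measurable
  rw [← Measure.map_apply hTm hB]
  have key : ∀ ε : ℝ, 0 < ε → ∀ A : Set F, MeasurableSet A → A ⊆ {y | 2 * ε ≤ ‖y‖} →
      ν' A = ν.map T A := by
    intro ε hε A hA hAε
    -- A continuous cutoff, `0` for `‖y‖ ≤ ε` and `1` for `‖y‖ ≥ 2ε`. Weighted by `v`, both measures
    -- become finite, and they are compared on bounded continuous functions.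
    let v : F → ℝ := fun y => max 0 (min 1 (‖y‖ / ε - 1))
    have hvc : Continuous v := by fun_prop
    have hv0 : ∀ y, 0 ≤ v y := fun y => le_max_left _ _
    have hv1 : ∀ y, v y ≤ 1 := fun y => max_le zero_le_one (min_le_left _ _)
    have hvz : ∀ y, ‖y‖ ≤ ε → v y = 0 := fun y hy => by
      have : ‖y‖ / ε ≤ 1 := (div_le_one hε).2 hy
      exact max_eq_left ((min_le_right _ _).trans (by linarith))
    have hve : ∀ y, 2 * ε ≤ ‖y‖ → v y = 1 := fun y hy => by
      have : 2 ≤ ‖y‖ / ε := (le_div_iff₀ hε).2 hy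
      simp only [v]
      rw [min_eq_left (by linarith), max_eq_right zero_le_one]
    have hfin : ∀ (κ : Measure F), κ {y | ε ≤ ‖y‖} < ∞ →
        IsFiniteMeasure (κ.withDensity fun y => ENNReal.ofReal (v y)) := fun κ hκ => by
      refine ⟨?_⟩
      rw [withDensity_apply _ MeasurableSet.univ, Measure.restrict_univ]
      have hms : MeasurableSet {y : F | ε ≤ ‖y‖} := measurableSet_le measurable_const measurable_norm
      refine lt_of_le_of_lt (lintegral_mono (g := {y | ε ≤ ‖y‖}.indicator 1) fun y => ?_) (by
        rwa [lintegral_indicator_one hms])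
      by_cases hy : ε ≤ ‖y‖
      · simp [Set.indicator, hy, hv1 y]
      · simp [hvz y (not_le.1 hy).le]
    have f1 : IsFiniteMeasure (ν'.withDensity fun y => ENNReal.ofReal (v y)) :=
      hfin _ (measure_lt_top_of_lintegral_levyWeight hν'.lintegral_lt_top hε)
    -- Since `T` is continuous and fixes `0`, test functions vanishing near the origin of `F` pull
    -- back to such functions on `E`. The margin `ε / 2` also places `{ε ≤ ‖T x‖}` inside `{δ ≤
    -- ‖x‖}`.
    obtain ⟨δ, hδ, hTδ⟩ : ∃ δ > 0, ∀ x, ‖x‖ ≤ δ → ‖T x‖ ≤ ε / 2 := by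
      have := Metric.continuous_iff.1 hT 0 (ε / 2) (by positivity)
      obtain ⟨δ, hδ, h⟩ := this
      refine ⟨δ / 2, by positivity, fun x hx => ?_⟩
      have := h x (by rw [dist_zero_right]; linarith)
      rw [hT0, dist_zero_right] at this
      exact this.le
    have f2 : IsFiniteMeasure ((ν.map T).withDensity fun y => ENNReal.ofReal (v y)) := by
      refine hfin _ ?_
      rw [Measure.map_apply hTm (measurableSet_le measurable_const measurable_norm)]
      refine lt_of_le_of_lt (measure_mono fun x hx => ?_)
        (measure_lt_top_of_lintegral_levyWeight hν.lintegral_lt_top hδ)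
      by_contra hx'
      have := hTδ x (not_le.1 hx').le
      have hx2 : ε ≤ ‖T x‖ := hx
      linarith
    have heq : (ν'.withDensity fun y => ENNReal.ofReal (v y)) =
        (ν.map T).withDensity fun y => ENNReal.ofReal (v y) := by
      refine ext_of_forall_integral_eq_of_IsFiniteMeasure fun g => ?_
      rw [integral_withDensity_ofReal hvc.measurable hv0,
        integral_withDensity_ofReal hvc.measurable hv0,
        integral_map hTm.aemeasurable (by fun_prop)]
      let f : F →ᵇ ℝ := BoundedContinuousFunction.ofNormedAddCommGroup
        (fun y => v y * g y) (by fun_prop) ‖g‖ (fun y => by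
          rw [norm_mul, Real.norm_of_nonneg (hv0 y)]
          exact (mul_le_mul (hv1 y) (g.norm_coe_le_norm y) (norm_nonneg _) zero_le_one).trans
            (one_mul _).le)
      let f' : E →ᵇ ℝ := f.compContinuous ⟨T, hT⟩
      have t1 := hν'.tendsto f ε hε (fun y hy => by simp [f, hvz y hy])
      have t2 := hν.tendsto f' δ hδ (fun x hx => by
        simp [f', f, hvz (T x) ((hTδ x hx).trans (by linarith))])
      refine tendsto_nhds_unique t1 (t2.congr fun n => ?_)
      rw [integral_map hTm.aemeasurable (by fun_prop)]
      rfl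
    have hset : ∀ κ : Measure F, κ.withDensity (fun y => ENNReal.ofReal (v y)) A = κ A :=
      fun κ => by
      rw [withDensity_apply _ hA, setLIntegral_congr_fun (g := fun _ => 1) hA]
      · simp
      · intro y hy
        simp [hve y (hAε hy)]
    rw [← hset ν', ← hset (ν.map T), heq]
  -- Exhaust `B`, which omits the origin, by pieces bounded away from it.
  have hBU : B = ⋃ k : ℕ, B ∩ {y | 2 * (1 / ((k : ℝ) + 1)) ≤ ‖y‖} := by
    rw [← inter_iUnion]
    refine (inter_eq_left.2 fun y hy => ?_).symm
    have hy0 : 0 < ‖y‖ := norm_pos_iff.2 fun h => h0 (h ▸ hy)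
    obtain ⟨k, hk⟩ := exists_nat_one_div_lt (half_pos hy0)
    exact mem_iUnion.2 ⟨k, show 2 * (1 / ((k : ℝ) + 1)) ≤ ‖y‖ by linarith⟩
  have hmono : Monotone fun k : ℕ => B ∩ {y | 2 * (1 / ((k : ℝ) + 1)) ≤ ‖y‖} := by
    intro i j hij
    refine inter_subset_inter_right _ fun y hy => ?_
    have hy' : 2 * (1 / ((i : ℝ) + 1)) ≤ ‖y‖ := hy
    exact le_trans (mul_le_mul_of_nonneg_left (Nat.one_div_le_one_div hij) zero_le_two) hy'
  rw [hBU, hmono.measure_iUnion, hmono.measure_iUnion]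
  congr 1
  funext k
  exact key _ Nat.one_div_pos_of_nat _
    (hB.inter (measurableSet_le measurable_const measurable_norm)) inter_subset_right

end LevyWeight

/-! ### Uniform bounds for convolution roots on the line -/

section RealLine

/-- Near the origin an `n`-th root of a characteristic function is within `O(1/n)` of `1`. -/
theorem norm_charFun_root_sub_one_le {P Q : Measure ℝ} [IsProbabilityMeasure P]
    [IsProbabilityMeasure Q] {n : ℕ} (hn : 1 ≤ n) (h : ∀ t, charFun Q t ^ n = charFun P t)
    {δ : ℝ} (hδ : ∀ t, |t| ≤ δ → ‖charFun P t - 1‖ ≤ 1 / 2) {t : ℝ} (ht : |t| ≤ δ) :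
    n * ‖charFun Q t - 1‖ ≤ 3 * ‖charFun P t - 1‖ := by
  have hn0 : (n : ℂ) ≠ 0 := by exact_mod_cast (by omega : n ≠ 0)
  have hlog : ∀ s, |s| ≤ δ → ‖Complex.log (charFun P s)‖ ≤ 3 / 2 * ‖charFun P s - 1‖ :=
    fun s hs => by
    simpa using Complex.norm_log_one_add_half_le_self (z := charFun P s - 1) (hδ s hs)
  have hslit : ∀ s, |s| ≤ δ → charFun P s ∈ Complex.slitPlane := fun s hs => by
    have := Complex.mem_slitPlane_of_norm_lt_one (z := charFun P s - 1)
      ((hδ s hs).trans_lt (by norm_num))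
    simpa using this
  -- The quotient of the root by the principal branch of the `n`-th root of `charFun P`. It is
  -- continuous with values among the `n`-th roots of unity, a finite set, hence constant, and it
  -- equals `1` at `0`.
  let f : ℝ → ℂ := fun s => charFun Q s * Complex.exp (-(Complex.log (charFun P s) / n))
  let S : Set ℝ := Icc (-δ) δ
  have hS : ∀ {s}, s ∈ S ↔ |s| ≤ δ := abs_le.symm
  have hf : ContinuousOn f S := by
    refine (continuous_charFun.continuousOn).mul (Complex.continuous_exp.comp_continuousOn ?_)
    exact ((continuous_charFun.continuousOn.clog fun s hs => hslit s (hS.1 hs)).div_const _).neg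
  have hpow : ∀ s ∈ S, f s ^ n = 1 := fun s hs => by
    have hs' := hslit s (hS.1 hs)
    simp only [f]
    rw [mul_pow, h, ← Complex.exp_nat_mul, mul_neg, mul_div_cancel₀ _ hn0, Complex.exp_neg,
      Complex.exp_log (Complex.slitPlane_ne_zero hs'),
      mul_inv_cancel₀ (Complex.slitPlane_ne_zero hs')]
  have hfin : ({z : ℂ | z ^ n = 1}).Finite := by
    refine (Polynomial.nthRootsFinset n (1 : ℂ)).finite_toSet.subset fun z hz => ?_
    simpa [Polynomial.mem_nthRootsFinset (by omega : 0 < n)] using hz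
  have hconst : f t = f 0 := isPreconnected_Icc.constant_of_mapsTo (T := {z : ℂ | z ^ n = 1})
    hfin.isDiscrete hf hpow (hS.2 ht) (y := 0) (hS.2 (by simpa using (abs_nonneg t).trans ht))
  have hf0 : f 0 = 1 := by simp [f]
  have hQ : charFun Q t = Complex.exp (Complex.log (charFun P t) / n) := by
    have : charFun Q t * Complex.exp (-(Complex.log (charFun P t) / n)) = 1 := hconst.trans hf0
    rw [Complex.exp_neg] at this
    exact eq_of_mul_inv_eq_one this
  have hn1 : (1 : ℝ) ≤ n := by exact_mod_cast hn
  have hle : ‖Complex.log (charFun P t) / n‖ ≤ 1 := by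
    rw [norm_div, Complex.norm_natCast]
    refine (div_le_self (norm_nonneg _) hn1).trans ((hlog t ht).trans ?_)
    linarith [hδ t ht]
  have := Complex.norm_exp_sub_one_le hle
  rw [← hQ, norm_div, Complex.norm_natCast] at this
  calc n * ‖charFun Q t - 1‖ ≤ n * (2 * (‖Complex.log (charFun P t)‖ / n)) := by gcongr
    _ = 2 * ‖Complex.log (charFun P t)‖ := by field_simp
    _ ≤ 3 * ‖charFun P t - 1‖ := by linarith [hlog t ht]

theorem exists_norm_charFun_sub_one_le (P : Measure ℝ) [IsProbabilityMeasure P] {ε : ℝ}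
    (hε : 0 < ε) : ∃ δ > 0, ∀ t, |t| ≤ δ → ‖charFun P t - 1‖ ≤ ε := by
  have := Metric.continuous_iff.1 (continuous_charFun (μ := P)) 0 ε hε
  obtain ⟨δ, hδ, h⟩ := this
  refine ⟨δ / 2, by positivity, fun t ht => ?_⟩
  have := h t (by rw [Real.dist_eq, sub_zero]; linarith)
  rw [dist_eq_norm, charFun_zero] at this
  simpa using this.le

theorem re_charFun_real (Q : Measure ℝ) [IsFiniteMeasure Q] (t : ℝ) :
    (charFun Q t).re = ∫ x, Real.cos (t * x) ∂Q := by
  rw [charFun_apply_real]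
  have hi : Integrable (fun x : ℝ => Complex.exp (t * x * Complex.I)) Q := by
    refine Integrable.of_bound (by fun_prop) 1 (ae_of_all _ fun x => ?_)
    rw [← Complex.ofReal_mul, Complex.norm_exp_ofReal_mul_I]
  rw [← RCLike.re_eq_complex_re, ← integral_re hi]
  refine integral_congr_ae (ae_of_all _ fun x => ?_)
  simp only [RCLike.re_eq_complex_re]
  rw [← Complex.ofReal_mul, Complex.exp_ofReal_mul_I_re]

theorem im_charFun_real (Q : Measure ℝ) [IsFiniteMeasure Q] (t : ℝ) :
    (charFun Q t).im = ∫ x, Real.sin (t * x) ∂Q := by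
  rw [charFun_apply_real]
  have hi : Integrable (fun x : ℝ => Complex.exp (t * x * Complex.I)) Q := by
    refine Integrable.of_bound (by fun_prop) 1 (ae_of_all _ fun x => ?_)
    rw [← Complex.ofReal_mul, Complex.norm_exp_ofReal_mul_I]
  rw [← RCLike.im_eq_complex_im, ← integral_im hi]
  refine integral_congr_ae (ae_of_all _ fun x => ?_)
  simp only [RCLike.im_eq_complex_im]
  rw [← Complex.ofReal_mul, Complex.exp_ofReal_mul_I_im]

/-- The tail of `Q` is controlled by the average of `1 - charFun Q` near `0`, which is of order `ε /
n` by the root estimate. -/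
theorem measureReal_abs_gt_charFun_root_le {P Q : Measure ℝ} [IsProbabilityMeasure P]
    [IsProbabilityMeasure Q] {n : ℕ} (hn : 1 ≤ n) (h : ∀ t, charFun Q t ^ n = charFun P t)
    {δ ε : ℝ} (hδ0 : 0 < δ) (hε : ε ≤ 1 / 2) (hδ : ∀ t, |t| ≤ δ → ‖charFun P t - 1‖ ≤ ε) :
    n * Q.real {x | 2 / δ < |x|} ≤ 6 * ε := by
  have hn0 : (0 : ℝ) < n := by exact_mod_cast hn
  have h1 := measureReal_abs_gt_le_integral_charFun (μ := Q) (r := 2 / δ) (by positivity)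
  have h2 : ‖∫ t in (-2 * (2 / δ)⁻¹)..(2 * (2 / δ)⁻¹), 1 - charFun Q t‖ ≤
      (3 * ε / n) * |2 * (2 / δ)⁻¹ - -2 * (2 / δ)⁻¹| := by
    refine intervalIntegral.norm_integral_le_of_norm_le_const fun t ht => ?_
    have e1 : 2 * (2 / δ)⁻¹ = δ := by field_simp
    have e2 : -2 * (2 / δ)⁻¹ = -δ := by field_simp
    rw [e1, e2, uIoc_of_le (by linarith)] at ht
    have ht' : |t| ≤ δ := abs_le.2 ⟨ht.1.le, ht.2⟩
    have := norm_charFun_root_sub_one_le hn h (fun s hs => (hδ s hs).trans hε) ht'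
    rw [norm_sub_rev, le_div_iff₀ hn0]
    linarith [hδ t ht']
  have e : |2 * (2 / δ)⁻¹ - -2 * (2 / δ)⁻¹| = 2 * δ := by
    rw [show 2 * (2 / δ)⁻¹ - -2 * (2 / δ)⁻¹ = 2 * δ by field_simp; ring, abs_of_pos (by positivity)]
  rw [e] at h2
  calc n * Q.real {x | 2 / δ < |x|} ≤ n * (2⁻¹ * (2 / δ) * (3 * ε / n * (2 * δ))) := by
        gcongr; exact h1.trans (by gcongr)
    _ = 6 * ε := by field_simp; ring

/-- On `|x| ≤ 2 / δ` the weight is dominated by a multiple of `1 - cos (δ x)`, whose integral is the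
real part of `1 - charFun (Q n) δ`. Beyond that range the tail estimate applies. -/
theorem isLevyBounded_of_charFun_pow {P : Measure ℝ} [IsProbabilityMeasure P]
    {Q : ℕ → Measure ℝ} (hQp : ∀ n, IsProbabilityMeasure (Q n))
    (hQ : ∀ n, 1 ≤ n → ∀ t, charFun (Q n) t ^ n = charFun P t) :
    IsLevyBounded fun n => (n : ℝ≥0∞) • Q n := by
  have key : ∀ (ε δ : ℝ), 0 < δ → ε ≤ 1 / 2 → (∀ t, |t| ≤ δ → ‖charFun P t - 1‖ ≤ ε) →
      ∀ n : ℕ, ((n : ℝ≥0∞) • Q n) {x | 2 / δ < |x|} ≤ ENNReal.ofReal (6 * ε) := by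
    intro ε δ hδ hε h n
    rcases Nat.eq_zero_or_pos n with rfl | hn
    · simp
    have := measureReal_abs_gt_charFun_root_le hn (hQ n hn) hδ hε h
    rw [Measure.smul_apply, smul_eq_mul, ← ofReal_measureReal, ← ENNReal.ofReal_natCast,
      ← ENNReal.ofReal_mul (by positivity)]
    exact ENNReal.ofReal_le_ofReal this
  constructor
  · obtain ⟨δ, hδ0, hδ⟩ := exists_norm_charFun_sub_one_le P (ε := 1 / 2) (by norm_num)
    -- The constant inverts `1 - cos y ≥ (2 / π²) y²`, valid for `|y| ≤ π`, at `y = δ x`.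
    let K : ℝ := Real.pi ^ 2 / (2 * δ ^ 2)
    have hK : 0 ≤ K := by positivity
    -- Both constants come from `‖charFun P - 1‖ ≤ 1 / 2`: the root estimate gives `3 · 1/2` and the
    -- tail estimate `6 · 1/2`.
    refine ⟨(K * (3 / 2)).toNNReal + 3, fun n => ?_⟩
    rcases Nat.eq_zero_or_pos n with rfl | hn
    · simp
    have hpt : ∀ x : ℝ, ENNReal.ofReal (levyWeight x) ≤
        ENNReal.ofReal (K * (1 - Real.cos (δ * x))) + {x | 2 / δ < |x|}.indicator 1 x := by
      intro x
      by_cases hx : 2 / δ < |x|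
      · rw [Set.indicator_of_mem (by exact hx), Pi.one_apply]
        refine le_trans ?_ le_add_self
        simpa using levyWeight_le_one x
      · refine le_trans (ENNReal.ofReal_le_ofReal ?_) le_self_add
        have hx2 : |δ * x| ≤ Real.pi := by
          rw [abs_mul, abs_of_pos hδ0]
          have := (le_div_iff₀ hδ0).1 (not_lt.1 hx)
          linarith [Real.pi_gt_three]
        have h2 : 2 / Real.pi ^ 2 * (δ * x) ^ 2 ≤ 1 - Real.cos (δ * x) := by
          have := Real.cos_le_one_sub_mul_cos_sq hx2
          linarith
        calc levyWeight x ≤ x ^ 2 := by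
              refine (min_le_right _ _).trans ?_
              rw [Real.norm_eq_abs, sq_abs]
          _ = K * (2 / Real.pi ^ 2 * (δ * x) ^ 2) := by simp only [K]; field_simp
          _ ≤ _ := by gcongr
    have hms : MeasurableSet {x : ℝ | 2 / δ < |x|} :=
      measurableSet_lt measurable_const (by fun_prop)
    refine (lintegral_mono hpt).trans ?_
    rw [lintegral_add_right _ (measurable_one.indicator hms), lintegral_indicator_one hms,
      ENNReal.coe_add]
    refine add_le_add ?_ ?_
    · rw [lintegral_smul_measure, ← ofReal_integral_eq_lintegral_ofReal]
      · rw [smul_eq_mul, ← ENNReal.ofReal_natCast, ← ENNReal.ofReal_mul (by positivity)]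
        refine ENNReal.ofReal_le_ofReal ?_
        have hint : Integrable (fun x => Real.cos (δ * x)) (Q n) :=
          Integrable.of_bound (by fun_prop) 1 (ae_of_all _ fun x => Real.abs_cos_le_one _)
        rw [integral_const_mul, integral_sub (integrable_const _) hint, ← re_charFun_real]
        have hre : 1 - (charFun (Q n) δ).re ≤ ‖charFun (Q n) δ - 1‖ := by
          have := Complex.abs_re_le_norm (charFun (Q n) δ - 1)
          rw [Complex.sub_re, Complex.one_re, abs_sub_comm] at this
          exact (le_abs_self _).trans this
        have hb := norm_charFun_root_sub_one_le hn (hQ n hn) hδ (t := δ) (abs_of_pos hδ0).le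
        have h3 := hδ δ (abs_of_pos hδ0).le
        simp only [integral_const, probReal_univ, smul_eq_mul, mul_one]
        calc (n : ℝ) * (K * (1 - (charFun (Q n) δ).re))
            ≤ n * (K * ‖charFun (Q n) δ - 1‖) := by gcongr
          _ = K * (n * ‖charFun (Q n) δ - 1‖) := by ring
          _ ≤ K * (3 / 2) := by gcongr; linarith
      · refine Integrable.of_bound (by fun_prop) (K * 2) (ae_of_all _ fun x => ?_)
        rw [norm_mul, Real.norm_of_nonneg hK]
        gcongr
        rw [Real.norm_eq_abs, abs_le]
        constructor <;> linarith [Real.cos_le_one (δ * x), Real.neg_one_le_cos (δ * x)]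
      · exact ae_of_all _ fun x => mul_nonneg hK (by linarith [Real.cos_le_one (δ * x)])
    · refine (key (1 / 2) δ hδ0 le_rfl hδ n).trans ?_
      norm_num
  · intro ε hε
    have hε' : (0 : ℝ) < min (1 / 2) ((ε : ℝ) / 6) := by positivity
    obtain ⟨δ, hδ0, hδ⟩ := exists_norm_charFun_sub_one_le P hε'
    refine ⟨2 / δ, fun n => (key _ δ hδ0 (min_le_left _ _) hδ n).trans ?_⟩
    rw [← ENNReal.ofReal_coe_nnreal]
    refine ENNReal.ofReal_le_ofReal ?_
    linarith [min_le_right (1 / 2 : ℝ) ((ε : ℝ) / 6)]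

end RealLine

/-! ### The Lévy-Khintchine formula on the line -/

section LevyKhintchine

/-- Here `g n` tends to `0`, so `n log (1 + g n)` differs from `n g n` by at most `‖n g n‖ ‖g n‖`,
which also tends to `0`. -/
theorem tendsto_one_add_pow_exp {l : Filter ℕ} (hl : l ≤ atTop) {g : ℕ → ℂ} {z : ℂ}
    (hg : Tendsto (fun n : ℕ => (n : ℂ) * g n) l (𝓝 z)) :
    Tendsto (fun n => (1 + g n) ^ n) l (𝓝 (Complex.exp z)) := by
  have hg0 : Tendsto g l (𝓝 0) := by
    have h1 : Tendsto (fun n : ℕ => (n : ℂ)⁻¹) l (𝓝 0) :=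
      (tendsto_inv_atTop_nhds_zero_nat (𝕜 := ℂ)).mono_left hl
    have h2 := hg.mul h1
    rw [mul_zero] at h2
    refine h2.congr' ?_
    filter_upwards [hl (eventually_ge_atTop 1)] with n hn
    have : (n : ℂ) ≠ 0 := by exact_mod_cast (by omega : n ≠ 0)
    field_simp
  have hsmall : ∀ᶠ n in l, ‖g n‖ < 1 / 2 := by
    have := hg0.norm
    rw [norm_zero] at this
    exact (tendsto_order.1 this).2 _ (by norm_num)
  have hlog : Tendsto (fun n : ℕ => (n : ℂ) * Complex.log (1 + g n)) l (𝓝 z) := by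
    have hd : Tendsto (fun n : ℕ => (n : ℂ) * Complex.log (1 + g n) - n * g n) l (𝓝 0) := by
      have hb : Tendsto (fun n : ℕ => ‖(n : ℂ) * g n‖ * ‖g n‖) l (𝓝 0) := by
        simpa using hg.norm.mul hg0.norm
      refine squeeze_zero_norm' ?_ hb
      filter_upwards [hsmall] with n hn
      have h1 := Complex.norm_log_one_add_sub_self_le (z := g n) (by linarith)
      have h2 : (1 - ‖g n‖)⁻¹ ≤ 2 := by
        rw [inv_le_comm₀ (by linarith) (by norm_num)]; linarith
      rw [← mul_sub, norm_mul, norm_mul, mul_assoc]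
      gcongr
      refine h1.trans ?_
      nlinarith [sq_nonneg ‖g n‖]
    simpa using hd.add hg
  refine ((Complex.continuous_exp.tendsto z).comp hlog).congr' ?_
  filter_upwards [hsmall] with n hn
  have hne : 1 + g n ≠ 0 := fun h => by
    rw [eq_neg_of_add_eq_zero_right h, norm_neg, norm_one] at hn
    norm_num at hn
  simp only [Function.comp_apply]
  rw [Complex.exp_nat_mul, Complex.exp_log hne]

theorem abs_sin_sub_self_le (y : ℝ) : |Real.sin y - y| ≤ |y| ^ 3 / 6 := by
  wlog hy : 0 < y with H
  · rcases eq_or_lt_of_le (not_lt.1 hy) with rfl | h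
    · simp
    · have := H (-y) (by linarith)
      rw [Real.sin_neg, abs_neg, ← abs_neg] at this
      convert this using 2
      ring
  rw [abs_of_pos hy, abs_le]
  constructor
  · linarith [Real.sin_gt_sub_cube hy]
  · have : 0 < y ^ 3 := by positivity
    linarith [Real.sin_lt hy]

theorem exists_boundedContinuousFunction_eq {f : ℝ → ℝ} (hf : Continuous f) {C : ℝ}
    (hC : ∀ x, 1 ≤ |x| → |f x| ≤ C) : ∃ g : ℝ →ᵇ ℝ, ∀ x, g x = f x := by
  obtain ⟨K, hK⟩ := (isCompact_Icc (a := (-1 : ℝ)) (b := 1)).exists_bound_of_continuousOn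
    hf.continuousOn
  refine ⟨BoundedContinuousFunction.ofNormedAddCommGroup f hf (max C K) fun x => ?_, fun x => rfl⟩
  rcases le_total 1 |x| with h | h
  · exact (hC x h).trans (le_max_left _ _)
  · exact (hK x (abs_le.1 h)).trans (le_max_right _ _)

theorem levyWeight_of_one_le {x : ℝ} (hx : 1 ≤ |x|) : levyWeight x = 1 := by
  have : 1 ≤ |x| ^ 2 := one_le_pow₀ hx
  simpa [levyWeight] using this

theorem levyWeight_of_le_one {x : ℝ} (hx : |x| ≤ 1) : levyWeight x = x ^ 2 := by
  have : |x| ^ 2 ≤ 1 := pow_le_one₀ (abs_nonneg x) hx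
  rw [levyWeight, Real.norm_eq_abs, min_eq_right this, sq_abs]

/-- Weak convergence only tests the weight times a bounded continuous function. The factorization
follows from `cos (t x) - 1 = -2 sin² (t x / 2)`, and the value at `0` turns the atom of `G` into
the Gaussian term. -/
theorem exists_cos_kernel (t : ℝ) : ∃ g : ℝ →ᵇ ℝ,
    (∀ x, levyWeight x * g x = Real.cos (t * x) - 1) ∧ g 0 = -(t ^ 2 / 2) := by
  let f : ℝ → ℝ := fun x => -(t ^ 2 / 2 * Real.sinc (t * x / 2) ^ 2 * max 1 (x ^ 2))
  have hf : Continuous f := by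
    have := Real.continuous_sinc
    fun_prop
  have hw : ∀ x, levyWeight x * f x = Real.cos (t * x) - 1 := fun x => by
    have h1 : levyWeight x * max 1 (x ^ 2) = x ^ 2 := by
      rw [levyWeight, Real.norm_eq_abs, sq_abs, min_mul_max, one_mul]
    have h2 : t * x / 2 * Real.sinc (t * x / 2) = Real.sin (t * x / 2) := by
      by_cases h : t * x / 2 = 0
      · simp [h]
      · rw [Real.sinc_of_ne_zero h, mul_div_cancel₀ _ h]
    have h3 : Real.cos (t * x) = 1 - 2 * Real.sin (t * x / 2) ^ 2 := by
      rw [Real.sin_sq_eq_half_sub]; ring_nf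
    rw [h3, ← h2]
    simp only [f]
    linear_combination (-(t ^ 2 / 2 * Real.sinc (t * x / 2) ^ 2)) * h1
  obtain ⟨g, hg⟩ := exists_boundedContinuousFunction_eq hf (C := 2) fun x hx => by
    have := hw x
    rw [levyWeight_of_one_le hx, one_mul] at this
    rw [this, abs_le]
    constructor <;> linarith [Real.cos_le_one (t * x), Real.neg_one_le_cos (t * x)]
  exact ⟨g, fun x => by rw [hg, hw], by rw [hg]; simp [f]⟩

/-- Centring by `t sin x`, unlike the truncation `t x 1_{|x| ≤ 1}`, is continuous. The difference is
`O(|x|³)` at the origin, so division by the weight leaves a continuous function with value `0`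
there. -/
theorem exists_sin_kernel (t : ℝ) : ∃ g : ℝ →ᵇ ℝ,
    (∀ x, levyWeight x * g x = Real.sin (t * x) - t * Real.sin x) ∧ g 0 = 0 := by
  let f : ℝ → ℝ := fun x => (Real.sin (t * x) - t * Real.sin x) / levyWeight x
  have hw : ∀ x, levyWeight x * f x = Real.sin (t * x) - t * Real.sin x := fun x => by
    by_cases hx : x = 0
    · simp [hx]
    · have := levyWeight_pos hx
      simp only [f]
      field_simp
  have hcube : ∀ x, |Real.sin (t * x) - t * Real.sin x| ≤ (|t| ^ 3 + |t|) * |x| ^ 3 := fun x => by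
    have h1 := abs_sin_sub_self_le (t * x)
    have h2 := mul_le_mul_of_nonneg_left (abs_sin_sub_self_le x) (abs_nonneg t)
    rw [← abs_mul] at h2
    rw [abs_mul, mul_pow] at h1
    have e : Real.sin (t * x) - t * Real.sin x =
        (Real.sin (t * x) - t * x) - t * (Real.sin x - x) := by ring
    rw [e]
    refine (abs_sub _ _).trans ?_
    have h3 : 0 ≤ |t| ^ 3 * |x| ^ 3 := by positivity
    have h4 : 0 ≤ |t| * |x| ^ 3 := by positivity
    nlinarith
  have hf : Continuous f := by
    rw [continuous_iff_continuousAt]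
    intro x
    by_cases hx : x = 0
    · subst hx
      have hlim : Tendsto (fun x : ℝ => (|t| ^ 3 + |t|) * |x|) (𝓝 0) (𝓝 0) := by
        have : Continuous fun x : ℝ => (|t| ^ 3 + |t|) * |x| := by fun_prop
        simpa using this.tendsto 0
      have hf0 : f 0 = 0 := by simp [f]
      rw [ContinuousAt, hf0]
      refine squeeze_zero_norm' ?_ hlim
      filter_upwards [Metric.closedBall_mem_nhds (0 : ℝ) one_pos] with x hx
      have hx1 : |x| ≤ 1 := by simpa using hx
      by_cases hx0 : x = 0
      · simp [hx0, hf0]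
      · have hx2 : 0 < x ^ 2 := by positivity
        simp only [f]
        rw [levyWeight_of_le_one hx1, Real.norm_eq_abs, abs_div, abs_of_pos hx2, div_le_iff₀ hx2]
        refine (hcube x).trans (le_of_eq ?_)
        rw [← sq_abs x]; ring
    · exact ContinuousAt.div (by fun_prop) continuous_levyWeight.continuousAt
        (levyWeight_pos hx).ne'
  obtain ⟨g, hg⟩ := exists_boundedContinuousFunction_eq hf (C := 1 + |t|) fun x hx => by
    simp only [f]
    rw [levyWeight_of_one_le hx, div_one]
    refine (abs_sub _ _).trans ?_
    rw [abs_mul]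
    exact add_le_add (Real.abs_sin_le_one _)
      (mul_le_of_le_one_right (abs_nonneg t) (Real.abs_sin_le_one _))
  exact ⟨g, fun x => by rw [hg, hw], by rw [hg]; simp [f]⟩

theorem integrable_of_abs_le_levyWeight {ν : Measure ℝ}
    (h : ∫⁻ x, ENNReal.ofReal (levyWeight x) ∂ν < ∞) {f : ℝ → ℝ} (hf : Measurable f) {C : ℝ}
    (hC : ∀ x, |f x| ≤ C * levyWeight x) : Integrable f ν := by
  have hw : Integrable (fun x : ℝ => levyWeight x) ν :=
    ⟨continuous_levyWeight.aestronglyMeasurable,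
      (hasFiniteIntegral_iff_ofReal (ae_of_all _ levyWeight_nonneg)).2 h⟩
  exact (hw.const_mul C).mono' hf.aestronglyMeasurable (ae_of_all _ hC)

theorem integrable_levyWeight_mul {ν : Measure ℝ}
    (h : ∫⁻ x, ENNReal.ofReal (levyWeight x) ∂ν < ∞) (g : ℝ →ᵇ ℝ) :
    Integrable (fun x => levyWeight x * g x) ν := by
  refine integrable_of_abs_le_levyWeight h
    (continuous_levyWeight.mul g.continuous).measurable (C := ‖g‖) fun x => ?_
  rw [abs_mul, abs_of_nonneg (levyWeight_nonneg x), mul_comm]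
  exact mul_le_mul_of_nonneg_right (g.norm_coe_le_norm x) (levyWeight_nonneg x)

/-- A limit of the centred Lévy exponents of the `n`-th roots, in terms of the limit `G` of the
measures `min(1, x²) n Q n`. -/
theorem exists_charFun_eq_exp_of_weak_limit {l : Ultrafilter ℕ} (hl : (l : Filter ℕ) ≤ atTop)
    {P : Measure ℝ} [IsProbabilityMeasure P] {Q : ℕ → Measure ℝ}
    (hQp : ∀ n, IsProbabilityMeasure (Q n))
    (hQ : ∀ n, 1 ≤ n → ∀ t, charFun (Q n) t ^ n = charFun P t) {G : Measure ℝ}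
    (hG : ∀ g : ℝ →ᵇ ℝ, Tendsto (fun n : ℕ => ∫ x, levyWeight x * g x ∂((n : ℝ≥0∞) • Q n)) l
      (𝓝 (∫ x, g x ∂G))) :
    ∃ c : ℝ, ∀ (t : ℝ) (gc gs : ℝ →ᵇ ℝ),
      (∀ x, levyWeight x * gc x = Real.cos (t * x) - 1) →
      (∀ x, levyWeight x * gs x = Real.sin (t * x) - t * Real.sin x) →
      charFun P t = Complex.exp (((∫ x, gc x ∂G : ℝ) : ℂ) +
        ((∫ x, gs x ∂G) + t * c : ℝ) * Complex.I) := by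
  have hcosi : ∀ (n : ℕ) (t : ℝ), Integrable (fun x => Real.cos (t * x)) (Q n) := fun n t =>
    Integrable.of_bound (by fun_prop) 1 (ae_of_all _ fun x => Real.abs_cos_le_one _)
  have hsini : ∀ (n : ℕ) (t : ℝ), Integrable (fun x => Real.sin (t * x)) (Q n) := fun n t =>
    Integrable.of_bound (by fun_prop) 1 (ae_of_all _ fun x => Real.abs_sin_le_one _)
  have hcos : ∀ (t : ℝ) (g : ℝ →ᵇ ℝ), (∀ x, levyWeight x * g x = Real.cos (t * x) - 1) →
      Tendsto (fun n : ℕ => n * ((charFun (Q n) t).re - 1)) l (𝓝 (∫ x, g x ∂G)) := by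
    intro t g hg
    refine (hG g).congr fun n => ?_
    simp only [hg]
    rw [integral_smul_measure, integral_sub (hcosi n t) (integrable_const _), re_charFun_real]
    simp
  have hsin : ∀ (t : ℝ) (g : ℝ →ᵇ ℝ),
      (∀ x, levyWeight x * g x = Real.sin (t * x) - t * Real.sin x) →
      Tendsto (fun n : ℕ => n * ((charFun (Q n) t).im - t * (charFun (Q n) 1).im)) l
        (𝓝 (∫ x, g x ∂G)) := by
    intro t g hg
    refine (hG g).congr fun n => ?_
    simp only [hg]
    have h1 := hsini n 1
    simp only [one_mul] at h1
    rw [integral_smul_measure, integral_sub (hsini n t) (h1.const_mul t), integral_const_mul,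
      im_charFun_real, im_charFun_real]
    simp
  -- The root estimate bounds `n Im φ_n` only near `0`, so a limit `y` is first taken at a small
  -- `δ`. The sine kernel for `δ` then transfers convergence to the point `1`.
  obtain ⟨c, hc⟩ : ∃ c : ℝ, Tendsto (fun n : ℕ => n * (charFun (Q n) 1).im) l (𝓝 c) := by
    obtain ⟨δ, hδ0, hδ⟩ := exists_norm_charFun_sub_one_le P (ε := 1 / 2) (by norm_num)
    have hbd : ∀ n : ℕ, n * (charFun (Q n) δ).im ∈ Icc (-(3 / 2) : ℝ) (3 / 2) := fun n => by
      rcases Nat.eq_zero_or_pos n with rfl | hn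
      · norm_num
      have h1 := norm_charFun_root_sub_one_le hn (hQ n hn) hδ (t := δ) (abs_of_pos hδ0).le
      have h2 := hδ δ (abs_of_pos hδ0).le
      have h3 := Complex.abs_im_le_norm (charFun (Q n) δ - 1)
      rw [Complex.sub_im, Complex.one_im, sub_zero] at h3
      rw [mem_Icc, ← abs_le, abs_mul, abs_of_nonneg (Nat.cast_nonneg n)]
      have := mul_le_mul_of_nonneg_left h3 (Nat.cast_nonneg (α := ℝ) n)
      linarith
    obtain ⟨y, -, hy⟩ := isCompact_iff_ultrafilter_le_nhds.1 (isCompact_Icc)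
      (l.map fun n : ℕ => n * (charFun (Q n) δ).im) (by
        rw [le_principal_iff, Ultrafilter.coe_map, mem_map]
        exact Filter.mem_of_superset univ_mem fun n _ => hbd n)
    obtain ⟨g, hg, -⟩ := exists_sin_kernel δ
    refine ⟨(y - ∫ x, g x ∂G) / δ, ?_⟩
    refine ((Tendsto.sub (show Tendsto (fun n : ℕ => n * (charFun (Q n) δ).im) l (𝓝 y) from hy)
      (hsin δ g hg)).div_const δ).congr fun n => ?_
    field_simp
    ring
  refine ⟨c, fun t gc gs hgc hgs => ?_⟩
  have h1 := hcos t gc hgc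
  have h2 := (hsin t gs hgs).add (hc.const_mul t)
  have h3 : Tendsto (fun n : ℕ => (n : ℂ) * (charFun (Q n) t - 1)) l
      (𝓝 (((∫ x, gc x ∂G : ℝ) : ℂ) + ((∫ x, gs x ∂G) + t * c : ℝ) * Complex.I)) := by
    refine (((Complex.continuous_ofReal.tendsto _).comp h1).add
      (((Complex.continuous_ofReal.tendsto _).comp h2).mul_const Complex.I)).congr fun n => ?_
    conv_rhs => rw [← Complex.re_add_im (charFun (Q n) t)]
    simp only [Function.comp_apply]
    push_cast
    ring
  refine tendsto_nhds_unique (f := fun n => (1 + (charFun (Q n) t - 1)) ^ n)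
    (tendsto_const_nhds.congr' ?_) (tendsto_one_add_pow_exp hl h3)
  filter_upwards [hl (eventually_ge_atTop 1)] with n hn
  rw [add_sub_cancel, hQ n hn]

theorem measurable_sin_sub_truncation :
    Measurable fun x : ℝ => Real.sin x - x * (Icc (-1 : ℝ) 1).indicator 1 x :=
  Real.measurable_sin.sub (measurable_id.mul (measurable_one.indicator measurableSet_Icc))

theorem abs_sin_sub_truncation_le (x : ℝ) :
    |Real.sin x - x * (Icc (-1 : ℝ) 1).indicator 1 x| ≤ 1 * levyWeight x := by
  by_cases hx : |x| ≤ 1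
  · rw [Set.indicator_of_mem (by exact abs_le.1 hx), levyWeight_of_le_one hx, Pi.one_apply,
      mul_one, one_mul, ← sq_abs x]
    refine (abs_sin_sub_self_le x).trans ?_
    nlinarith [sq_nonneg |x|, abs_nonneg x]
  · rw [Set.indicator_of_notMem (fun h : x ∈ Icc (-1 : ℝ) 1 => hx (abs_le.2 h)), levyWeight_of_one_le (not_le.1 hx).le]
    simpa using Real.abs_sin_le_one x

/-- The Lévy-Khintchine representation of an infinitely divisible probability measure on `ℝ`, with
the Lévy measure obtained as a limit of the measures `n Q n`. -/
theorem exists_isLevyLimit_hasLevyKhintchine {l : Ultrafilter ℕ} (hl : (l : Filter ℕ) ≤ atTop)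
    {P : Measure ℝ} [IsProbabilityMeasure P] {Q : ℕ → Measure ℝ}
    (hQp : ∀ n, IsProbabilityMeasure (Q n))
    (hQ : ∀ n, 1 ≤ n → ∀ t, charFun (Q n) t ^ n = charFun P t) :
    ∃ ν : Measure ℝ, IsLevyLimit l (fun n => (n : ℝ≥0∞) • Q n) ν ∧
      ∃ β σ : ℝ, HasLevyKhintchine P β σ ν := by
  obtain ⟨G, hGfin, hG⟩ := (isLevyBounded_of_charFun_pow hQp hQ).exists_weak_limit l
  have hν := isLevyLimit_levyPart hG
  obtain ⟨c, hc⟩ := exists_charFun_eq_exp_of_weak_limit hl hQp hQ hG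
  set ν := levyPart G with hνdef
  -- The integral subtracted from `c` replaces the centring by `sin x` with the truncation. The
  -- Gaussian variance is the atom of `G` at `0`.
  refine ⟨ν, hν, c - ∫ x, (Real.sin x - x * (Icc (-1 : ℝ) 1).indicator 1 x) ∂ν,
    √(G.real {0}), Real.sqrt_nonneg _, ⟨hν.apply_zero, ?_⟩, fun t => ?_⟩
  · simpa [levyWeight] using hν.lintegral_lt_top
  obtain ⟨gc, hgc, hgc0⟩ := exists_cos_kernel t
  obtain ⟨gs, hgs, hgs0⟩ := exists_sin_kernel t
  rw [hc t gc gs hgc hgs, Real.sq_sqrt measureReal_nonneg]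
  have hsplit : ∀ g : ℝ →ᵇ ℝ,
      ∫ x, g x ∂G = (∫ x, levyWeight x * g x ∂ν) + G.real {0} * g 0 := fun g => by
    rw [hνdef, integral_levyPart, ← integral_add_compl (measurableSet_singleton (0 : ℝ))
      (g.integrable G), add_comm, integral_singleton, smul_eq_mul]
  have hic := integrable_levyWeight_mul hν.lintegral_lt_top gc
  have his := integrable_levyWeight_mul hν.lintegral_lt_top gs
  have hid := integrable_of_abs_le_levyWeight hν.lintegral_lt_top measurable_sin_sub_truncation
    abs_sin_sub_truncation_le
  have hrestr : ν.restrict {0}ᶜ = ν :=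
    Measure.restrict_eq_self_of_ae_mem (compl_mem_ae_iff.2 hν.apply_zero)
  have hpt : ∀ γ : ℝ, Complex.exp (Complex.I * (t * γ : ℝ)) - 1 -
      Complex.I * ((t * γ * (Set.Icc (-1 : ℝ) 1).indicator 1 γ : ℝ) : ℂ) =
      ((levyWeight γ * gc γ : ℝ) : ℂ) + ((levyWeight γ * gs γ +
        t * (Real.sin γ - γ * (Icc (-1 : ℝ) 1).indicator 1 γ) : ℝ) : ℂ) * Complex.I := fun γ => by
    rw [hgc, hgs, mul_comm Complex.I, Complex.exp_mul_I, ← Complex.ofReal_cos,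
      ← Complex.ofReal_sin]
    push_cast
    ring
  simp only [hrestr, hpt]
  rw [integral_add hic.ofReal ((his.add (hid.const_mul t)).ofReal.mul_const _),
    integral_mul_const, integral_complex_ofReal, integral_complex_ofReal, integral_add his (hid.const_mul t),
    integral_const_mul, hsplit gc, hsplit gs, hgc0, hgs0]
  congr 1
  push_cast
  ring

end LevyKhintchine

/-! ### Finite-dimensional bounds, directed suprema and linear sections -/

/-- In the maximum norm some coordinate attains `‖x‖`, so both the weight and the tails are bounded
by sums over the coordinates. -/
theorem isLevyBounded_pi {ι : Type*} [Fintype ι] {m : ℕ → Measure (ι → ℝ)}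
    (h : ∀ i, IsLevyBounded fun n => (m n).map fun x => x i) : IsLevyBounded m := by
  classical
  have hm : ∀ i, Measurable fun x : ι → ℝ => x i := measurable_pi_apply
  constructor
  · choose C hC using fun i => (h i).lintegral_le
    refine ⟨∑ i, C i, fun n => ?_⟩
    have hpt : ∀ x : ι → ℝ,
        ENNReal.ofReal (levyWeight x) ≤ ∑ i, ENNReal.ofReal (levyWeight (x i)) := by
      intro x
      rcases isEmpty_or_nonempty ι with hι | hι
      · simp [Subsingleton.elim x 0]
      · obtain ⟨i, hi⟩ := Finite.exists_max fun i => ‖x i‖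
        have : ‖x‖ = ‖x i‖ := le_antisymm ((pi_norm_le_iff_of_nonneg (norm_nonneg _)).2 hi)
          (norm_le_pi_norm x i)
        have e : levyWeight x = levyWeight (x i) := by rw [levyWeight, levyWeight, this]
        rw [e]
        exact Finset.single_le_sum (f := fun i => ENNReal.ofReal (levyWeight (x i)))
          (fun _ _ => zero_le) (Finset.mem_univ i)
    have hmw : Measurable fun x : ℝ => ENNReal.ofReal (levyWeight x) :=
      continuous_levyWeight.measurable.ennreal_ofReal
    refine (lintegral_mono hpt).trans ?_
    rw [lintegral_finsetSum _ (by exact fun i _ => hmw.comp (hm i)), ENNReal.ofNNReal_finsetSum]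
    refine Finset.sum_le_sum fun i _ => ?_
    have := hC i n
    rwa [lintegral_map hmw (hm i)] at this
  · intro ε hε
    -- The added `1` keeps the denominator positive when `ι` is empty.
    have hε' : 0 < ε / (Fintype.card ι + 1) := by positivity
    choose R hR using fun i => (h i).tail_le _ hε'
    refine ⟨∑ i, |R i|, fun n => ?_⟩
    have hsub : {x : ι → ℝ | ∑ i, |R i| < ‖x‖} ⊆ ⋃ i, (fun x => x i) ⁻¹' {y : ℝ | R i < ‖y‖} := by
      intro x hx
      by_contra hcon
      have hle : ∀ i, ‖x i‖ ≤ ∑ i, |R i| := fun i => by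
        have : ‖x i‖ ≤ R i := not_lt.1 fun hi => hcon (mem_iUnion.2 ⟨i, hi⟩)
        exact (this.trans (le_abs_self _)).trans
          (Finset.single_le_sum (f := fun i => |R i|) (fun _ _ => abs_nonneg _) (Finset.mem_univ i))
      have hx' : ∑ i, |R i| < ‖x‖ := hx
      exact absurd ((pi_norm_le_iff_of_nonneg
        (Finset.sum_nonneg fun _ _ => abs_nonneg _)).2 hle) (not_le.2 hx')
    calc m n {x : ι → ℝ | ∑ i, |R i| < ‖x‖}
        ≤ ∑ i, m n ((fun x => x i) ⁻¹' {y : ℝ | R i < ‖y‖}) :=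
          (measure_mono hsub).trans (measure_iUnion_fintype_le _ _)
      _ ≤ ∑ _i : ι, ((ε / (Fintype.card ι + 1) : ℝ≥0) : ℝ≥0∞) := Finset.sum_le_sum fun i _ => by
          have := hR i n
          rwa [Measure.map_apply (hm i) (measurableSet_lt measurable_const measurable_norm)] at this
      _ ≤ ε := by
          rw [← ENNReal.ofNNReal_finsetSum, ENNReal.coe_le_coe, Finset.sum_const, nsmul_eq_mul,
            Finset.card_univ, mul_div_assoc', div_le_iff₀ (by positivity), mul_comm]
          gcongr
          simp

/-- An increasing directed family of measures has a setwise supremum, which is a measure. -/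
theorem exists_measure_apply_eq_iSup {X ι : Type*} [MeasurableSpace X] [Preorder ι]
    [IsDirectedOrder ι] (κ : ι → Measure X)
    (hκ : ∀ A, MeasurableSet A → Monotone fun i => κ i A) :
    ∃ m : Measure X, ∀ A, MeasurableSet A → m A = ⨆ i, κ i A := by
  refine ⟨Measure.ofMeasurable (fun A _ => ⨆ i, κ i A) (by simp) fun f hf hd => ?_,
    fun A hA => Measure.ofMeasurable_apply A hA⟩
  simp only [measure_iUnion hd hf, ENNReal.tsum_eq_iSup_sum]
  -- Countable additivity is an exchange of suprema, together with the fact that finite sums commute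
  -- with directed monotone suprema.
  rw [iSup_comm]
  exact iSup_congr fun s => (ENNReal.finsetSum_iSup_of_monotone fun a => hκ _ (hf a)).symm

/-- A right inverse onto the range composed with a projection to the range. Surjectivity cannot be
asked of `coord Γ`, since the functionals in `Γ` may be linearly dependent. -/
theorem exists_generalized_inverse {K V W : Type*} [Field K] [AddCommGroup V] [Module K V]
    [AddCommGroup W] [Module K W] (f : V →ₗ[K] W) :
    ∃ s : W →ₗ[K] V, ∀ v, f (s (f v)) = f v := by
  obtain ⟨r, hr⟩ := f.rangeRestrict.exists_rightInverse_of_surjective f.range_rangeRestrict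
  obtain ⟨p, hp⟩ := f.range.subtype.exists_leftInverse_of_injective f.range.ker_subtype
  refine ⟨r ∘ₗ p, fun v => ?_⟩
  have h1 : p (f v) = f.rangeRestrict v := LinearMap.congr_fun hp (f.rangeRestrict v)
  have h2 : f.rangeRestrict (r (f.rangeRestrict v)) = f.rangeRestrict v :=
    LinearMap.congr_fun hr (f.rangeRestrict v)
  simp only [LinearMap.comp_apply, h1]
  exact congrArg Subtype.val h2

/-! ### Finite-dimensional coordinates of cylindrical measures -/

variable {U : Type*} [NormedAddCommGroup U] [NormedSpace ℝ U]

/-- The map `u ↦ (⟨u, a⟩)_{a ∈ Γ}` from `U` to `ℝ^Γ`. -/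
def coord (Γ : Finset (StrongDual ℝ U)) : U →ₗ[ℝ] (Γ → ℝ) :=
  LinearMap.pi fun a => a.1.toLinearMap

@[simp]
theorem coord_apply (Γ : Finset (StrongDual ℝ U)) (u : U) (a : Γ) : coord Γ u a = a.1 u := rfl

theorem measurable_coord {Γ Δ : Finset (StrongDual ℝ U)} (h : Γ ⊆ Δ) :
    @Measurable _ _ (cylSigma (Δ : Set (StrongDual ℝ U))) _ (coord Γ) := by
  let _ : MeasurableSpace U := cylSigma (Δ : Set (StrongDual ℝ U))
  exact measurable_pi_lambda _ fun a => measurable_functional (h a.2)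

theorem exists_eq_coord_preimage {Γ : Finset (StrongDual ℝ U)} {A : Set U}
    (hA : MeasurableSet[cylSigma (Γ : Set (StrongDual ℝ U))] A) :
    ∃ B : Set (Γ → ℝ), MeasurableSet B ∧ A = coord Γ ⁻¹' B := by
  obtain ⟨n, a, B, ha, hB, rfl⟩ := mem_cylinderSets_of_measurableSet Γ hA
  refine ⟨(fun (x : Γ → ℝ) (i : Fin n) => x ⟨a i, ha i⟩) ⁻¹' B, ?_, rfl⟩
  exact (measurable_pi_lambda _ fun i => measurable_pi_apply _) hB

/-- A linear section of `coord Γ` over its range. -/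
def coordSection (Γ : Finset (StrongDual ℝ U)) : (Γ → ℝ) →ₗ[ℝ] U :=
  (exists_generalized_inverse (coord Γ)).choose

theorem coord_coordSection (Γ : Finset (StrongDual ℝ U)) (u : U) :
    coord Γ (coordSection Γ (coord Γ u)) = coord Γ u :=
  (exists_generalized_inverse (coord Γ)).choose_spec u

theorem apply_coordSection {Γ : Finset (StrongDual ℝ U)} {a : StrongDual ℝ U} (ha : a ∈ Γ)
    (u : U) : a (coordSection Γ (coord Γ u)) = a u :=
  congrFun (coord_coordSection Γ u) ⟨a, ha⟩

theorem coord_coordSection_of_subset {Γ Δ : Finset (StrongDual ℝ U)} (h : Γ ⊆ Δ) (u : U) :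
    coord Γ (coordSection Δ (coord Δ u)) = coord Γ u :=
  funext fun a => apply_coordSection (h a.2) u

theorem continuous_apply_coordSection (Γ : Finset (StrongDual ℝ U)) (a : StrongDual ℝ U) :
    Continuous fun x => a (coordSection Γ x) :=
  LinearMap.continuous_of_finiteDimensional (a.toLinearMap ∘ₗ coordSection Γ)

theorem continuous_coord_coordSection (Γ Δ : Finset (StrongDual ℝ U)) :
    Continuous fun x => coord Γ (coordSection Δ x) :=
  LinearMap.continuous_of_finiteDimensional (coord Γ ∘ₗ coordSection Δ)

/-- Each functional composed with the section is linear on a finite-dimensional space, so measures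
on `ℝ^Γ` can be pushed to `U` for any cylindrical σ-algebra. -/
theorem measurable_coordSection (Γ : Finset (StrongDual ℝ U)) (Δ : Set (StrongDual ℝ U)) :
    @Measurable _ _ _ (cylSigma Δ) (coordSection Γ) := by
  refine measurable_generateFrom ?_
  rintro Z ⟨n, a, B, -, hB, rfl⟩
  have : Measurable fun x : Γ → ℝ => proj a (coordSection Γ x) :=
    measurable_pi_lambda _ fun i =>
      (continuous_apply_coordSection Γ (a i)).measurable
  exact this hB

namespace CylindricalMeasure

theorem map_restriction_of_subset (ν : CylindricalMeasure U) {Γ Δ : Finset (StrongDual ℝ U)}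
    (h : Γ ⊆ Δ) {F : Type*} [MeasurableSpace F] {L : U → F}
    (hL : @Measurable _ _ (cylSigma (Γ : Set (StrongDual ℝ U))) _ L) :
    @Measure.map U F (cylSigma (Δ : Set (StrongDual ℝ U))) _ L (ν.restriction Δ) =
      @Measure.map U F (cylSigma (Γ : Set (StrongDual ℝ U))) _ L (ν.restriction Γ) := by
  have hle := cylSigma_mono (Finset.coe_subset.mpr h)
  rw [← map_id_restriction ν h, @Measure.map_map _ _ _ (cylSigma (Δ : Set (StrongDual ℝ U)))
    (cylSigma (Γ : Set (StrongDual ℝ U))) _ _ _ _ hL (measurable_id'' hle)]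
  rfl

theorem image_eq_map_restriction (ν : CylindricalMeasure U) {Γ : Finset (StrongDual ℝ U)}
    {a : StrongDual ℝ U} (ha : a ∈ Γ) :
    ν.image a = @Measure.map U ℝ (cylSigma (Γ : Set (StrongDual ℝ U))) _ (fun u => a u)
      (ν.restriction Γ) :=
  (map_restriction_of_subset ν (Finset.singleton_subset_iff.2 ha)
    (measurable_functional (by simp))).symm

/-- The image of a cylindrical measure under `coord Γ`. -/
def coordImage (ν : CylindricalMeasure U) (Γ : Finset (StrongDual ℝ U)) : Measure (Γ → ℝ) :=
  @Measure.map U _ (cylSigma (Γ : Set (StrongDual ℝ U))) _ (coord Γ) (ν.restriction Γ)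

theorem map_coordImage (ν : CylindricalMeasure U) (Γ : Finset (StrongDual ℝ U)) {F : Type*}
    [MeasurableSpace F] {T : (Γ → ℝ) → F} (hT : Measurable T) :
    (ν.coordImage Γ).map T =
      @Measure.map U F (cylSigma (Γ : Set (StrongDual ℝ U))) _ (fun u => T (coord Γ u))
        (ν.restriction Γ) :=
  @Measure.map_map _ _ _ (cylSigma (Γ : Set (StrongDual ℝ U))) _ _ _ _ _ hT
    (measurable_coord subset_rfl)

theorem map_coordImage_eval (ν : CylindricalMeasure U) {Γ : Finset (StrongDual ℝ U)} (a : Γ) :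
    (ν.coordImage Γ).map (fun x => x a) = ν.image a.1 := by
  rw [map_coordImage ν Γ (measurable_pi_apply a), image_eq_map_restriction ν a.2]
  rfl

theorem map_coordImage_apply_coordSection (ν : CylindricalMeasure U)
    {Γ : Finset (StrongDual ℝ U)} {a : StrongDual ℝ U} (ha : a ∈ Γ) :
    (ν.coordImage Γ).map (fun x => a (coordSection Γ x)) = ν.image a := by
  rw [map_coordImage ν Γ (continuous_apply_coordSection Γ a).measurable, image_eq_map_restriction ν ha]
  simp only [apply_coordSection ha]

theorem map_coordImage_coord_coordSection (ν : CylindricalMeasure U)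
    {Γ Δ : Finset (StrongDual ℝ U)} (h : Γ ⊆ Δ) :
    (ν.coordImage Δ).map (fun x => coord Γ (coordSection Δ x)) = ν.coordImage Γ := by
  rw [map_coordImage ν Δ (continuous_coord_coordSection Γ Δ).measurable, coordImage,
    ← map_restriction_of_subset ν h (measurable_coord subset_rfl)]
  simp only [coord_coordSection_of_subset h]

end CylindricalMeasure

/-! ### Characteristic functions of one-dimensional images -/

namespace CylindricalProbabilityMeasure

theorem isProbabilityMeasure_image (μ : CylindricalProbabilityMeasure U) (a : StrongDual ℝ U) :
    IsProbabilityMeasure (μ.toCylindricalMeasure.image a) := by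
  refine ⟨?_⟩
  rw [CylindricalMeasure.image_apply _ _ MeasurableSet.univ]
  exact μ.apply_univ

theorem image_diracZero (a : StrongDual ℝ U) :
    (diracZero : CylindricalProbabilityMeasure U).toCylindricalMeasure.image a =
      Measure.dirac 0 := by
  ext B hB
  rw [CylindricalMeasure.image_apply _ _ hB, Measure.dirac_apply' _ hB]
  have h0 : (0 : U) ∈ (fun u => a u) ⁻¹' B ↔ (0 : ℝ) ∈ B := by simp
  by_cases h : (0 : ℝ) ∈ B
  · rw [Set.indicator_of_mem h]
    exact Set.indicator_of_mem (h0.2 h) _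
  · rw [Set.indicator_of_notMem h]
    exact Set.indicator_of_notMem (mt h0.1 h) _

theorem image_conv (μ₁ μ₂ : CylindricalProbabilityMeasure U) (a : StrongDual ℝ U) :
    (conv μ₁ μ₂).toCylindricalMeasure.image a =
      (μ₁.toCylindricalMeasure.image a).conv (μ₂.toCylindricalMeasure.image a) := by
  let _ : MeasurableSpace U := cylSigma (({a} : Finset (StrongDual ℝ U)) : Set (StrongDual ℝ U))
  have := measurableAdd₂_cylSigma (({a} : Finset (StrongDual ℝ U)) : Set (StrongDual ℝ U))
  have := isProbabilityMeasure_restriction μ₁ {a}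
  have := isProbabilityMeasure_restriction μ₂ {a}
  have hm : Measurable (a : StrongDual ℝ U).toLinearMap.toAddMonoidHom :=
    measurable_functional (a := a) (by simp)
  have hr : (conv μ₁ μ₂).toCylindricalMeasure.restriction {a} = convOn μ₁ μ₂ {a} := by
    refine Measure.ext fun A hA => ?_
    rw [CylindricalMeasure.restriction_apply _ _ hA, conv_apply _ _ _ hA]
  exact (congrArg (Measure.map fun u => a u) hr).trans (Measure.map_conv_addMonoidHom _ hm)

theorem charFun_image_convPow (μ : CylindricalProbabilityMeasure U) (a : StrongDual ℝ U) (t : ℝ)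
    (n : ℕ) : charFun ((convPow μ n).toCylindricalMeasure.image a) t =
      charFun (μ.toCylindricalMeasure.image a) t ^ n := by
  induction n with
  | zero => simp [convPow, image_diracZero]
  | succ n ih =>
    have := isProbabilityMeasure_image (convPow μ n) a
    have := isProbabilityMeasure_image μ a
    rw [convPow, image_conv, charFun_conv, ih, pow_succ]

end CylindricalProbabilityMeasure

/-! ### Gluing the finite-dimensional limits -/

section Assembly

variable {l : Ultrafilter ℕ} {ρ : ℕ → CylindricalProbabilityMeasure U}
  {κ : ∀ Γ : Finset (StrongDual ℝ U), Measure (Γ → ℝ)}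

/-- The map `coord Γ ∘ coordSection Δ` carries the `Δ`-images of the roots to their `Γ`-images, and
limits along the same ultrafilter respect continuous maps off the origin. The case `Γ = Δ` is also
used: it handles vectors outside the range of `coord Γ`. -/
theorem preimage_coordSection_coord_eq
    (hκ : ∀ Γ, IsLevyLimit l
      (fun n => (n : ℝ≥0∞) • (ρ n).toCylindricalMeasure.coordImage Γ) (κ Γ))
    {Γ Δ : Finset (StrongDual ℝ U)} (h : Γ ⊆ Δ) {B : Set (Γ → ℝ)} (hB : MeasurableSet B)
    (h0 : (0 : Γ → ℝ) ∉ B) : κ Δ (coordSection Δ ⁻¹' (coord Γ ⁻¹' B)) = κ Γ B := by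
  refine ((hκ Δ).preimage_eq (T := fun x => coord Γ (coordSection Δ x))
    (continuous_coord_coordSection Γ Δ) (by simp) ?_ hB h0).symm
  simp only [Measure.map_smul, CylindricalMeasure.map_coordImage_coord_coordSection _ h]
  exact hκ Γ

theorem preimage_coordSection_functional_eq
    (hκ : ∀ Γ, IsLevyLimit l
      (fun n => (n : ℝ≥0∞) • (ρ n).toCylindricalMeasure.coordImage Γ) (κ Γ))
    {Δ : Finset (StrongDual ℝ U)} {a : StrongDual ℝ U} (ha : a ∈ Δ) {ν : Measure ℝ}
    (hν : IsLevyLimit l (fun n => (n : ℝ≥0∞) • (ρ n).toCylindricalMeasure.image a) ν)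
    {B : Set ℝ} (hB : MeasurableSet B) (h0 : (0 : ℝ) ∉ B) :
    κ Δ (coordSection Δ ⁻¹' ((fun u => a u) ⁻¹' B)) = ν B := by
  refine ((hκ Δ).preimage_eq (T := fun x => a (coordSection Δ x))
    (continuous_apply_coordSection Δ a) (by simp)
      ?_ hB h0).symm
  simp only [Measure.map_smul, CylindricalMeasure.map_coordImage_apply_coordSection _ ha]
  exact hν

/-- Write `p = coord Γ ∘ coordSection Γ`, which is idempotent. No `p x` is a nonzero vector of the
kernel of `p`, so compatibility under `p` makes that kernel minus the origin null; the origin itself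
carries no mass. -/
theorem preimage_coordSection_zero_fiber
    (hκ : ∀ Γ, IsLevyLimit l
      (fun n => (n : ℝ≥0∞) • (ρ n).toCylindricalMeasure.coordImage Γ) (κ Γ))
    (Γ : Finset (StrongDual ℝ U)) : κ Γ (coordSection Γ ⁻¹' (coord Γ ⁻¹' {0})) = 0 := by
  set S : Set (Γ → ℝ) := coordSection Γ ⁻¹' (coord Γ ⁻¹' {0}) with hS
  have hSm : MeasurableSet S := measurable_coordSection Γ (Γ : Set (StrongDual ℝ U))
    (measurable_coord subset_rfl (measurableSet_singleton 0))
  have hB : MeasurableSet (S \ {0}) := hSm.diff (measurableSet_singleton 0)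
  have h := preimage_coordSection_coord_eq hκ (subset_refl Γ) hB (by simp)
  have hempty : coordSection Γ ⁻¹' (coord Γ ⁻¹' (S \ {0})) = ∅ := by
    refine eq_empty_of_forall_notMem fun x hx => hx.2 ?_
    have h1 : coord Γ (coordSection Γ (coord Γ (coordSection Γ x))) = 0 := hx.1
    rwa [coord_coordSection] at h1
  rw [hempty, measure_empty] at h
  refine measure_mono_null (t := (S \ {0}) ∪ {0}) (fun x hx => ?_)
    (measure_union_null h.symm (hκ Γ).apply_zero)
  by_cases hx0 : x = 0
  · exact Or.inr hx0
  · exact Or.inl ⟨hx, hx0⟩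

/-- Off the origin of `ℝ^Γ` the two masses agree. Over the origin `κ Γ` contributes nothing, while
`κ Δ` may charge vectors that `Γ` does not separate from `0`. -/
theorem preimage_coordSection_mono
    (hκ : ∀ Γ, IsLevyLimit l
      (fun n => (n : ℝ≥0∞) • (ρ n).toCylindricalMeasure.coordImage Γ) (κ Γ))
    {Γ Δ : Finset (StrongDual ℝ U)} (h : Γ ⊆ Δ) {A : Set U}
    (hA : MeasurableSet[cylSigma (Γ : Set (StrongDual ℝ U))] A) :
    κ Γ (coordSection Γ ⁻¹' A) ≤ κ Δ (coordSection Δ ⁻¹' A) := by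
  obtain ⟨B, hB, rfl⟩ := exists_eq_coord_preimage hA
  have hB' : MeasurableSet (B \ {0}) := hB.diff (measurableSet_singleton 0)
  calc κ Γ (coordSection Γ ⁻¹' (coord Γ ⁻¹' B))
      ≤ κ Γ (coordSection Γ ⁻¹' (coord Γ ⁻¹' (B \ {0})) ∪
          coordSection Γ ⁻¹' (coord Γ ⁻¹' {0})) := by
        refine measure_mono fun x hx => ?_
        by_cases hx0 : coord Γ (coordSection Γ x) = 0
        · exact Or.inr hx0
        · exact Or.inl ⟨hx, hx0⟩
    _ ≤ κ Γ (coordSection Γ ⁻¹' (coord Γ ⁻¹' (B \ {0}))) + 0 := by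
        rw [← preimage_coordSection_zero_fiber hκ Γ]
        exact measure_union_le _ _
    _ = κ Δ (coordSection Δ ⁻¹' (coord Γ ⁻¹' (B \ {0}))) := by
        rw [add_zero, preimage_coordSection_coord_eq hκ subset_rfl hB' (by simp),
          preimage_coordSection_coord_eq hκ h hB' (by simp)]
    _ ≤ κ Δ (coordSection Δ ⁻¹' (coord Γ ⁻¹' B)) :=
        measure_mono (preimage_mono (preimage_mono sdiff_subset))

/-- By monotonicity the supersets of `Γ` are cofinal. The index set then no longer depends on `A`,
as is needed to see one measure on `C(U, Γ)`. -/
theorem iSup_preimage_coordSection_eq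
    (hκ : ∀ Γ, IsLevyLimit l
      (fun n => (n : ℝ≥0∞) • (ρ n).toCylindricalMeasure.coordImage Γ) (κ Γ))
    {Γ : Finset (StrongDual ℝ U)} {A : Set U}
    (hA : MeasurableSet[cylSigma (Γ : Set (StrongDual ℝ U))] A) :
    ⨆ Δ : {Δ : Finset (StrongDual ℝ U) // MeasurableSet[cylSigma (Δ : Set (StrongDual ℝ U))] A},
        κ Δ.1 (coordSection Δ.1 ⁻¹' A) =
      ⨆ Δ : Set.Ici Γ, κ Δ.1 (coordSection Δ.1 ⁻¹' A) := by
  classical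
  refine le_antisymm (iSup_le fun Δ => ?_) (iSup_le fun Δ => ?_)
  · exact (preimage_coordSection_mono hκ Finset.subset_union_right Δ.2).trans
      (le_iSup (fun Δ : Set.Ici Γ => κ Δ.1 (coordSection Δ.1 ⁻¹' A))
        ⟨Γ ∪ Δ.1, Finset.subset_union_left⟩)
  · exact le_iSup (fun Δ : {Δ : Finset (StrongDual ℝ U) //
        MeasurableSet[cylSigma (Δ : Set (StrongDual ℝ U))] A} => κ Δ.1 (coordSection Δ.1 ⁻¹' A))
      ⟨Δ.1, cylSigma_mono (Finset.coe_subset.mpr Δ.2) A hA⟩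

/-- The cylindrical measure whose value at a cylindrical set `A` is the supremum of the masses
that the finite-dimensional limits give to the complement of the origin in `A`. -/
def cylindricalLevyMeasure (hκ : ∀ Γ, IsLevyLimit l
      (fun n => (n : ℝ≥0∞) • (ρ n).toCylindricalMeasure.coordImage Γ) (κ Γ)) :
    CylindricalMeasure U where
  toFun A := ⨆ Δ : {Δ : Finset (StrongDual ℝ U) //
    MeasurableSet[cylSigma (Δ : Set (StrongDual ℝ U))] (A : Set U)},
      κ Δ.1 (coordSection Δ.1 ⁻¹' A)
  exists_restriction Γ := by
    classical
    let _ : MeasurableSpace U := cylSigma (Γ : Set (StrongDual ℝ U))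
    have hs : ∀ Δ : Finset (StrongDual ℝ U), Measurable (coordSection Δ : (Δ → ℝ) → U) := fun Δ =>
      measurable_coordSection Δ _
    obtain ⟨m, hm⟩ := exists_measure_apply_eq_iSup
      (fun Δ : Set.Ici Γ => (κ Δ.1).map (coordSection Δ.1)) fun A hA Δ Δ' h => by
        simp only [Measure.map_apply (hs _) hA]
        exact preimage_coordSection_mono hκ h (cylSigma_mono (Finset.coe_subset.mpr Δ.2) A hA)
    refine ⟨m, fun A hA => ?_⟩
    rw [hm A hA, iSup_preimage_coordSection_eq hκ hA]
    simp only [Measure.map_apply (hs _) hA]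

/-- For a Borel set that omits `0`, every term of the supremum over `Δ` containing `a` already
equals its `ν`-mass. -/
theorem image_cylindricalLevyMeasure_restrict (hκ : ∀ Γ, IsLevyLimit l
      (fun n => (n : ℝ≥0∞) • (ρ n).toCylindricalMeasure.coordImage Γ) (κ Γ))
    {a : StrongDual ℝ U} {ν : Measure ℝ}
    (hν : IsLevyLimit l (fun n => (n : ℝ≥0∞) • (ρ n).toCylindricalMeasure.image a) ν) :
    ((cylindricalLevyMeasure hκ).image a).restrict {0}ᶜ = ν := by
  ext B hB
  have hB' : MeasurableSet (B ∩ {0}ᶜ) := hB.inter (measurableSet_singleton 0).compl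
  rw [Measure.restrict_apply hB, CylindricalMeasure.image_apply _ _ hB']
  simp only [cylindricalLevyMeasure]
  rw [iSup_preimage_coordSection_eq hκ (Γ := {a}) (measurable_functional (by simp) hB')]
  have hterm : ∀ Δ : Set.Ici ({a} : Finset (StrongDual ℝ U)),
      κ Δ.1 (coordSection Δ.1 ⁻¹' ((fun u => a u) ⁻¹' (B ∩ {0}ᶜ))) = ν (B ∩ {0}ᶜ) := fun Δ =>
    preimage_coordSection_functional_eq hκ (Finset.singleton_subset_iff.1 Δ.2) hν hB' (by simp)
  simp only [hterm, iSup_const]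
  exact measure_inter_conull (compl_mem_ae_iff.2 hν.apply_zero)

end Assembly

end CylLevy

end

/-! ### The main theorem -/

theorem mainTheorem1 {U : Type*} [NormedAddCommGroup U] [NormedSpace ℝ U] [CompleteSpace U]
    [TopologicalSpace.SeparableSpace U]
    (μ : CylLevy.CylindricalProbabilityMeasure U) (hμ : μ.IsInfinitelyDivisible) :
    ∃ ν : CylLevy.CylindricalMeasure U, ∀ a : StrongDual ℝ U, ∃ β σ : ℝ,
      CylLevy.HasLevyKhintchine (μ.toCylindricalMeasure.image a) β σ
        ((ν.image a).restrict ({0}ᶜ : Set ℝ)) := by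
  have hroot : ∀ n : ℕ, ∃ ρ : CylLevy.CylindricalProbabilityMeasure U,
      1 ≤ n → μ = CylLevy.CylindricalProbabilityMeasure.convPow ρ n := fun n => by
    by_cases hn : 1 ≤ n
    · obtain ⟨ρ, hρ⟩ := hμ n hn
      exact ⟨ρ, fun _ => hρ⟩
    -- For `n = 0` any value serves, since the factor `n` annihilates the measure.
    · exact ⟨μ, fun h => absurd h hn⟩
  choose ρ hρ using hroot
  have hprob := fun (a : StrongDual ℝ U) (n : ℕ) => (ρ n).isProbabilityMeasure_image a
  have hchar : ∀ (a : StrongDual ℝ U) (n : ℕ), 1 ≤ n → ∀ t,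
      charFun ((ρ n).toCylindricalMeasure.image a) t ^ n =
        charFun (μ.toCylindricalMeasure.image a) t := fun a n hn t => by
    conv_rhs => rw [hρ n hn]
    rw [CylLevy.CylindricalProbabilityMeasure.charFun_image_convPow]
  have hμp := μ.isProbabilityMeasure_image
  -- One ultrafilter for all `Γ` and all `a`: every limit below is taken along it, which makes them
  -- mutually compatible.
  let l : Ultrafilter ℕ := Filter.hyperfilter ℕ
  have hbdd : ∀ Γ : Finset (StrongDual ℝ U), CylLevy.IsLevyBounded
      fun n => (n : ℝ≥0∞) • (ρ n).toCylindricalMeasure.coordImage Γ := fun Γ =>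
    CylLevy.isLevyBounded_pi fun a => by
      simp only [Measure.map_smul, CylLevy.CylindricalMeasure.map_coordImage_eval]
      exact CylLevy.isLevyBounded_of_charFun_pow (hprob a.1) (hchar a.1)
  choose κ hκ using fun Γ => (hbdd Γ).exists_isLevyLimit l
  refine ⟨CylLevy.cylindricalLevyMeasure hκ, fun a => ?_⟩
  obtain ⟨ν, hν, h⟩ := CylLevy.exists_isLevyLimit_hasLevyKhintchine (l := l)
    Nat.hyperfilter_le_atTop (hprob a) (hchar a)
  rwa [CylLevy.image_cylindricalLevyMeasure_restrict hκ hν]
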